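/- Let $n\ge 2$, and take indices modulo $n+1$. For every finite field $\mathbb F_q$ with $q\equiv 1 \pmod 4$, let complex weights $H(f_0,\dots,f_n)$ be given for all monic $f_0,\dots,f_n\in\mathbb F_q[t]$, and put $$c_{a_0,\dots,a_n}(q)=\sum_{f_j\ \mathrm{monic},\ \deg f_j=a_j}H(f_0,\dots,f_n).$$ Let $\left(\frac{f}{g}\right)$ be the quadratic residue symbol in $\mathbb F_q[t]$; a prime is a monic irreducible polynomial, and $|p|=q^{\deg p}$. Assume the following four axioms. 1. (Twisted multiplicativity) If $\gcd(f_0\cdots f_n,g_0\cdots g_n)=1$, then $$H(f_0g_0,\dots,f_ng_n)=H(f_0,\dots,f_n)\,H(g_0,\dots,g_n)\prod_{i \bmod n+1}\left(\tfrac{f_i}{g_{i+1}}\right)\left(\tfrac{g_i}{f_{i+1}}\right).$$ 2. (Local-to-global) For each $(a_0,\dots,a_n)$ there are polynomials over $\mathbb C$ of degree at most $a_0+\dots+a_n$, independent of $q$ and $p$, such that $c_{a_0,\dots,a_n}(q)$ is the value of the first at $q$, $H(p^{a_0},\dots,p^{a_n})$ is the value of the second at $|p|$, and $H(p^{a_0},\dots,p^{a_n})=|p|^{a_0+\dots+a_n}c_{a_0,\dots,a_n}(|p|^{-1})$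 for all $q$ and all primes $p\in\mathbb F_q[t]$. 3. (Dominance) If $a_0+\dots+a_n\ge 2$, all terms of $H(p^{a_0},\dots,p^{a_n})$ have degree less than $\frac12(a_0+\dots+a_n-1)$ in $|p|$; equivalently, all terms of $c_{a_0,\dots,a_n}(q)$ have degree greater than $\frac12(a_0+\dots+a_n+1)$ in $q$. 4. (Initial conditions) $H(1,\dots,1,f_i,1,\dots,1)=1$ and $c_{0,\dots,0,a_i,0,\dots,0}(q)=q^{a_i}$. Fix $q$, an index $i$ modulo $n+1$, nonnegative integers $a_j$ for $j\ne i$, and a prime $p\in\mathbb F_q[t]$. Put $s=a_{i-1}+a_{i+1}$ and $$\Lambda(x)=\sum_{a_i\ge 0}c_{a_0,\dots,a_n}(q)\,x^{a_i},\qquad \lambda(x)=\sum_{a_i\ge 0}H(p^{a_0},\dots,p^{a_n})\,x^{a_i\deg p}.$$ (a) If $s$ is odd, then $\Lambda$ and $\lambda$ are polynomials of degrees at most $s-1$ and $(s-1)\deg p$ respectively, and $$(q^{1/2}x)^{s-1}\Lambda(q^{-1}x^{-1})=\Lambda(x),\qquad (q^{1/2}x)^{(s-1)\deg p}\lambda(q^{-1}x^{-1})=\lambda(x).$$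 (b) If $s$ is even, then $\Lambda$ and $\lambda$ are rational functions with denominators $1-qx$ and $1-x^{\deg p}$, and numerators of degrees at most $s$ and $s\deg p$ respectively, and $$(q^{1/2}x)^{s}(1-x^{-1})\Lambda(q^{-1}x^{-1})=(1-qx)\Lambda(x),$$ $$(q^{1/2}x)^{s\deg p}(1-q^{-\deg p}x^{-\deg p})\lambda(q^{-1}x^{-1})=(1-x^{\deg p})\lambda(x).$$ (c) Let $Z(x_0,\dots,x_n)=\sum_{a_0,\dots,a_n\ge0} c_{a_0,\dots,a_n}(q)x_0^{a_0}\cdots x_n^{a_n}$, and let $Z_{\mathrm{odd}}$ and $Z_{\mathrm{even}}$ be the sums of its terms with $a_{i-1}+a_{i+1}$ odd and even respectively. Let $\sigma_i$ be the substitution $x_i\mapsto q^{-1}x_i^{-1}$, $x_{i\pm1}\mapsto q^{1/2}x_ix_{i\pm1}$, fixing the other variables. Then $Z_{\mathrm{odd}}$ and $Z_{\mathrm{even}}$ are the expansions of formal power series in the variables $x_j$ $(j\neq i)$ with coefficients in the field $\mathbb C(x_i)$, and as identities of such series $$Z_{\mathrm{odd}}(\sigma_i(x_0,\dots,x_n))=q^{1/2}x_i\,Z_{\mathrm{odd}}(x_0,\dots,x_n),$$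 $$(1-x_i^{-1})\,Z_{\mathrm{even}}(\sigma_i(x_0,\dots,x_n))=(1-qx_i)\,Z_{\mathrm{even}}(x_0,\dots,x_n).$$ -/

import Mathlib

open Polynomial

noncomputable section

namespace AffineMDS

/-! ### Quadratic residue symbols in `F[t]` -/

/-- A prime of `F[t]`: a monic irreducible polynomial. -/
def IsPrimePoly {F : Type} [Field F] (p : F[X]) : Prop :=
  p.Monic ∧ Irreducible p

open Classical in
/-- The quadratic residue symbol `(f / p)` for `p` irreducible: `0` if `p` divides `f`, `1` if `f` is
a nonzero square modulo `p`, and `-1` otherwise. -/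
def primeSymbol {F : Type} [Field F] (f p : F[X]) : ℤ :=
  if p ∣ f then 0 else if ∃ h : F[X], p ∣ f - h ^ 2 then 1 else -1

open Classical in
/-- The quadratic residue symbol `(f / g)`, extended multiplicatively to monic `g`: the product of
`(f / p)` over the prime factors `p` of `g`, counted with multiplicity. -/
def residueSymbol {F : Type} [Field F] (f g : F[X]) : ℤ :=
  ((UniqueFactorizationMonoid.normalizedFactors g).map (primeSymbol f)).prod

/-! ### Local weights and global coefficients

Indices are taken modulo `n + 1`, i.e. in `ZMod (n + 1)`. -/

/-- A choice of weights `H(f_0, …, f_n) ∈ ℂ` over every finite field `F`. Only the values at tuples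
of monic polynomials over fields with `|F| ≡ 1 mod 4` are ever used. -/
abbrev LocalWeights (n : ℕ) : Type 1 :=
  ∀ (F : Type) [Field F] [Finite F], (ZMod (n + 1) → F[X]) → ℂ

/-- Tuples of monic polynomials with `deg f_i = a_i`. -/
def monicTuples {n : ℕ} (F : Type) [Field F] (a : ZMod (n + 1) → ℕ) :
    Set (ZMod (n + 1) → F[X]) :=
  {f | ∀ i, (f i).Monic ∧ (f i).natDegree = a i}

theorem finite_monicTuples {n : ℕ} (F : Type) [Field F] [Finite F] (a : ZMod (n + 1) → ℕ) :
    (monicTuples F a).Finite := by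
  have key : ∀ d : ℕ, {p : F[X] | p.Monic ∧ p.natDegree = d}.Finite := by
    intro d
    have hinj : Set.InjOn (fun (p : F[X]) (k : Fin (d + 1)) => p.coeff k)
        {p : F[X] | p.Monic ∧ p.natDegree = d} := by
      intro p hp r hr h
      ext k
      by_cases hk : k < d + 1
      · exact congrFun h ⟨k, hk⟩
      · rw [coeff_eq_zero_of_natDegree_lt (by have := hp.2; omega),
          coeff_eq_zero_of_natDegree_lt (by have := hr.2; omega)]
    exact Set.Finite.of_finite_image (Set.toFinite _) hinj
  have h := Set.Finite.pi' (fun i : ZMod (n + 1) => key (a i))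
  exact h

/-- The global coefficient `c_{a_0, …, a_n}(q)` over the field `F` with `q` elements:
the sum of `H(f_0, …, f_n)` over monic `f_i` of degree `a_i`. -/
def globalCoeff {n : ℕ} (H : LocalWeights n) (F : Type) [Field F] [Finite F]
    (a : ZMod (n + 1) → ℕ) : ℂ :=
  ∑ f ∈ (finite_monicTuples F a).toFinset, H F f

/-! ### The four axioms -/

/-- The four axioms, for local weights `H` given over all finite fields of order `q ≡ 1 mod 4`.
`c a` is the polynomial in `q` giving the global coefficients, and `h a` is the polynomial in
`|p| = q ^ deg p` giving the local weights at powers of a prime `p`. -/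
structure SatisfiesAxioms {n : ℕ} (H : LocalWeights n)
    (c h : (ZMod (n + 1) → ℕ) → ℂ[X]) : Prop where
  /-- Twisted multiplicativity. -/
  twisted_mul : ∀ (F : Type) [Field F] [Finite F], Nat.card F % 4 = 1 →
    ∀ f g : ZMod (n + 1) → F[X], (∀ i, (f i).Monic) → (∀ i, (g i).Monic) →
      IsCoprime (∏ i, f i) (∏ i, g i) →
      H F (fun i => f i * g i) = H F f * H F g *
        ∏ i, ((residueSymbol (f i) (g (i + 1)) : ℂ) * (residueSymbol (g i) (f (i + 1)) : ℂ))
  /-- Local-to-global principle: the degree bounds. -/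
  natDegree_c : ∀ a, (c a).natDegree ≤ ∑ i, a i
  natDegree_h : ∀ a, (h a).natDegree ≤ ∑ i, a i
  /-- Local-to-global principle: the global coefficients are polynomials in `q`. -/
  global_eq : ∀ (F : Type) [Field F] [Finite F], Nat.card F % 4 = 1 →
    ∀ a, globalCoeff H F a = (c a).eval (Nat.card F : ℂ)
  /-- Local-to-global principle: the local weights are polynomials in `|p|`. -/
  local_eq : ∀ (F : Type) [Field F] [Finite F], Nat.card F % 4 = 1 →
    ∀ p : F[X], IsPrimePoly p → ∀ a : ZMod (n + 1) → ℕ,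
      H F (fun i => p ^ a i) = (h a).eval ((Nat.card F : ℂ) ^ p.natDegree)
  /-- Local-to-global principle: `H(p^a) = |p|^(a_0 + ⋯ + a_n) c_a(|p|⁻¹)`. -/
  local_global : ∀ (F : Type) [Field F] [Finite F], Nat.card F % 4 = 1 →
    ∀ p : F[X], IsPrimePoly p → ∀ a : ZMod (n + 1) → ℕ,
      H F (fun i => p ^ a i) = ((Nat.card F : ℂ) ^ p.natDegree) ^ (∑ i, a i) *
        (c a).eval (((Nat.card F : ℂ) ^ p.natDegree)⁻¹)
  /-- Dominance principle, with the exceptions `a = 0` and `a = (0, …, 0, 1, 0, …, 0)`: all terms of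
  `h a` have degree less than `(∑ a - 1) / 2`; equivalently, all terms of `c a` have degree greater
  than `(∑ a + 1) / 2`. -/
  dominance_h : ∀ a, 2 ≤ ∑ i, a i → ∀ k ∈ (h a).support, 2 * k + 1 < ∑ i, a i
  dominance_c : ∀ a, 2 ≤ ∑ i, a i → ∀ k ∈ (c a).support, (∑ i, a i) + 1 < 2 * k
  /-- Initial conditions. -/
  initial_local : ∀ (F : Type) [Field F] [Finite F], Nat.card F % 4 = 1 →
    ∀ (i : ZMod (n + 1)) (f : F[X]), f.Monic → H F (Pi.mulSingle i f) = 1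
  initial_global : ∀ (F : Type) [Field F] [Finite F], Nat.card F % 4 = 1 →
    ∀ (i : ZMod (n + 1)) (k : ℕ), globalCoeff H F (Pi.single i k) = (Nat.card F : ℂ) ^ k

/-! ### One-variable series -/

/-- `Λ_{a_0, …, â_i, …, a_n}(x) = ∑_{k ≥ 0} c_{a_0, …, k, …, a_n}(q) x^k`
(`k` in position `i`; the value `a i` is ignored). -/
def globalSeries {n : ℕ} (H : LocalWeights n) (F : Type) [Field F] [Finite F]
    (i : ZMod (n + 1)) (a : ZMod (n + 1) → ℕ) : PowerSeries ℂ :=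
  PowerSeries.mk fun k => globalCoeff H F (Function.update a i k)

/-- `λ_{p^{a_0}, …, p^{a_n}}(x) = ∑_{k ≥ 0} H(p^{a_0}, …, p^k, …, p^{a_n}) x^{k deg p}`
(`p^k` in position `i`; the value `a i` is ignored). -/
def localSeries {n : ℕ} (H : LocalWeights n) {F : Type} [Field F] [Finite F] (p : F[X])
    (i : ZMod (n + 1)) (a : ZMod (n + 1) → ℕ) : PowerSeries ℂ :=
  PowerSeries.mk fun m =>
    if p.natDegree ∣ m then H F (fun j => p ^ Function.update a i (m / p.natDegree) j) else 0

/-- The rational function `R` has power series expansion `φ` at the origin. -/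
def HasExpansion (R : RatFunc ℂ) (φ : PowerSeries ℂ) : Prop :=
  (R : LaurentSeries ℂ) = (φ : LaurentSeries ℂ)

/-- `q^{1/2}`, as a constant rational function. -/
def sqrtC (q : ℕ) : RatFunc ℂ := RatFunc.C ((Real.sqrt q : ℝ) : ℂ)

/-- The substitution `x ↦ q⁻¹ x⁻¹` in a rational function. -/
def invSubst (q : ℕ) (R : RatFunc ℂ) : RatFunc ℂ :=
  RatFunc.eval RatFunc.C (((q : RatFunc ℂ) * RatFunc.X)⁻¹) R

/-! ### The multiple Dirichlet series and the transformations `σ_i` -/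

/-- `Z(x_0, …, x_n) = ∑ c_{a_0, …, a_n}(q) x_0^{a_0} ⋯ x_n^{a_n}`. -/
def Z {n : ℕ} (H : LocalWeights n) (F : Type) [Field F] [Finite F] :
    MvPowerSeries (ZMod (n + 1)) ℂ :=
  fun a => globalCoeff H F a

open Classical in
/-- The part of `W` consisting of the terms with `a_{i-1} + a_{i+1}` odd. -/
def oddPart {n : ℕ} (i : ZMod (n + 1)) (W : MvPowerSeries (ZMod (n + 1)) ℂ) :
    MvPowerSeries (ZMod (n + 1)) ℂ :=
  fun a => if Odd (a (i - 1) + a (i + 1)) then MvPowerSeries.coeff a W else 0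

open Classical in
/-- The part of `W` consisting of the terms with `a_{i-1} + a_{i+1}` even. -/
def evenPart {n : ℕ} (i : ZMod (n + 1)) (W : MvPowerSeries (ZMod (n + 1)) ℂ) :
    MvPowerSeries (ZMod (n + 1)) ℂ :=
  fun a => if Even (a (i - 1) + a (i + 1)) then MvPowerSeries.coeff a W else 0

/-- Power series in the variables `x_j`, `j ≠ i`, with coefficients in the field `ℂ(x_i)`. -/
abbrev SeriesOver {n : ℕ} (i : ZMod (n + 1)) : Type :=
  MvPowerSeries {j : ZMod (n + 1) // j ≠ i} (RatFunc ℂ)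

open Classical in
/-- The exponent tuple with `k` in position `i` and `b` in the other positions. -/
def insertExp {n : ℕ} (i : ZMod (n + 1)) (b : {j : ZMod (n + 1) // j ≠ i} →₀ ℕ) (k : ℕ) :
    ZMod (n + 1) →₀ ℕ :=
  Finsupp.equivFunOnFinite.symm fun j => if hj : j = i then k else b ⟨j, hj⟩

/-- `R`, a power series in the `x_j`, `j ≠ i`, over `ℂ(x_i)`, equals the formal power series `W`: each
of its coefficients expands to the corresponding power series in `x_i` contained in `W`. -/
def Represents {n : ℕ} (i : ZMod (n + 1)) (R : SeriesOver i)
    (W : MvPowerSeries (ZMod (n + 1)) ℂ) : Prop :=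
  ∀ b, HasExpansion (MvPowerSeries.coeff b R)
    (PowerSeries.mk fun k => MvPowerSeries.coeff (insertExp i b k) W)

open Classical in
/-- `R(σ_i(x_0, …, x_n))`, where `σ_i` replaces `x_i` by `q⁻¹ x_i⁻¹`, `x_{i ± 1}` by
`q^{1/2} x_i x_{i ± 1}`, and fixes the other variables. -/
def sigmaSubst {n : ℕ} (q : ℕ) (i : ZMod (n + 1)) (R : SeriesOver i) : SeriesOver i :=
  fun b => invSubst q (MvPowerSeries.coeff b R) *
    ∏ j : {j : ZMod (n + 1) // j ≠ i},
      (if j.1 = i + 1 ∨ j.1 = i - 1 then sqrtC q * RatFunc.X else 1) ^ b j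

end AffineMDS

end

open AffineMDS

namespace AffineMDS

noncomputable section


section Residues

variable {F : Type} [Field F]

/-! Fix all `f_j` with `j ≠ i` and sum over `f_i` alone. Twisted multiplicativity and quadratic
reciprocity (symmetric because `q ≡ 1 mod 4`) write this inner sum, up to a constant, as the
`L`-series of a quadratic character with squarefree conductor, times one local numerator for each
prime dividing some `f_j` (`exists_twistedSeries_pow_mul`). A prime `p` enters the conductor exactly
when its total exponent in `f_{i-1} f_{i+1}` is odd. The `L`-series has its classical functional
equation, proved from Gauss sums over `F[t]` (`hasFE_quadLSeries`). Hence the inner sum has a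
functional equation depending only on `s` as soon as the local factors have theirs
(`hasFE_twistedSeries`).

The local functional equations are obtained together with the global ones, by induction on the sum
of the `a_j` with `j ≠ i`. In the expansion of `Λ` over the `f_j`, every local factor has a smaller
exponent sum, except when all `f_j` are the powers `(t - α) ^ a_j` of one linear polynomial. There
are `q` such terms, and each has the numerator of the local series at norm `q`. So the numerator of
`Λ` minus `q` times this local numerator is self-reciprocal (`isPal_numer_sub`).

This holds for infinitely many `q`, hence as an identity between polynomials in `q`. By dominance,
the global numerator only has terms above a certain degree in `q`, and `q` times the local numerator
only has terms below it. Reciprocity respects this cut, so it holds for the two parts separately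
(`IsPal.separate`). This closes the induction in `isPal_coeffSeries`.

It remains to divide by `1 - q x` or `1 - x ^ deg p` when `s` is even, and to read the equations of
`Z` coefficientwise: `σ_i` multiplies the coefficient with given `a_{i-1}`, `a_{i+1}` by `(q^{1/2}
x_i) ^ s`. -/

theorem degree_mul_lt_add {a b : ℕ} {f g : F[X]} (hf : f.degree = a) (hg : g.degree < b) :
    (f * g).degree < (a + b : ℕ) := by
  rcases eq_or_ne g 0 with rfl | h0
  · simp
  · rw [degree_mul, hf]
    rw [degree_eq_natDegree h0] at hg ⊢
    norm_cast at hg ⊢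
    omega

/-! ### The residue functional -/

/-- The coefficient of `t⁻¹` in the expansion of `r / D` at infinity, for monic `D`. -/
def resCoeff (D r : F[X]) : F := (r %ₘ D).coeff (D.natDegree - 1)

theorem resCoeff_add (D r s : F[X]) : resCoeff D (r + s) = resCoeff D r + resCoeff D s := by
  simp [resCoeff, add_modByMonic]

theorem resCoeff_C_mul (D r : F[X]) (c : F) : resCoeff D (C c * r) = c * resCoeff D r := by
  rw [resCoeff, C_mul', smul_modByMonic, coeff_smul, smul_eq_mul, resCoeff]

@[simp] theorem resCoeff_zero (D : F[X]) : resCoeff D 0 = 0 := by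
  simp [resCoeff]

theorem resCoeff_of_degree_lt {D r : F[X]} (hD : D.Monic) (hr : r.degree < D.degree) :
    resCoeff D r = r.coeff (D.natDegree - 1) := by
  rw [resCoeff, (modByMonic_eq_self_iff hD).2 hr]

/-- The fractions `P r / (P Q)` and `r / Q` agree, and division with remainder scales by `P`. -/
theorem resCoeff_mul_left {P Q : F[X]} (hP : P.Monic) (hQ : Q.Monic) (r : F[X]) :
    resCoeff (P * Q) (P * r) = resCoeff Q r := by
  have key : (P * r) %ₘ (P * Q) = P * (r %ₘ Q) := by
    refine (div_modByMonic_unique (r /ₘ Q) (P * (r %ₘ Q)) (hP.mul hQ) ⟨?_, ?_⟩).2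
    · linear_combination P * modByMonic_add_div r Q
    · rw [degree_mul, degree_mul]
      exact WithBot.add_lt_add_left (degree_ne_bot.2 hP.ne_zero) (degree_modByMonic_lt r hQ)
  rw [resCoeff, resCoeff, key, hP.natDegree_mul hQ]
  -- For `Q = 1` the index `Q.natDegree - 1` is truncated to `0`, but then both remainders vanish.
  rcases Nat.eq_zero_or_pos Q.natDegree with h0 | h0
  · have : Q = 1 := hQ.natDegree_eq_zero.1 h0
    simp [this]
  · have hlt : (r %ₘ Q).natDegree ≤ Q.natDegree - 1 := by
      have := natDegree_modByMonic_lt r hQ (by rintro rfl; simp at h0)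
      omega
    rw [Nat.add_sub_assoc h0, coeff_mul_add_eq_of_natDegree_le le_rfl hlt, hP.coeff_natDegree,
      one_mul]

/-! ### Sums over polynomials of bounded degree -/

variable [Finite F]

theorem finite_setOf_degree_lt (F : Type) [Field F] [Finite F] (k : ℕ) :
    {r : F[X] | r.degree < k}.Finite := by
  have : Finite (degreeLT F k) := Finite.of_equiv _ (degreeLTEquiv F k).toEquiv.symm
  refine (Set.toFinite (degreeLT F k : Set F[X])).subset fun r hr => ?_
  exact mem_degreeLT.2 hr

/-- The polynomials of degree less than `k`. -/
def polysLT (F : Type) [Field F] [Finite F] (k : ℕ) : Finset F[X] :=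
  (finite_setOf_degree_lt F k).toFinset

@[simp] theorem mem_polysLT {k : ℕ} {r : F[X]} : r ∈ polysLT F k ↔ r.degree < k := by
  simp [polysLT]

theorem card_polysLT (k : ℕ) : (polysLT F k).card = Nat.card F ^ k := by
  have h : Nat.card (degreeLT F k) = Nat.card F ^ k := by
    rw [Nat.card_congr (degreeLTEquiv F k).toEquiv, Nat.card_fun, Nat.card_fin]
  rw [← h, ← Nat.card_eq_finsetCard]
  exact Nat.card_congr (Equiv.subtypeEquivRight fun r => by rw [mem_polysLT, mem_degreeLT])

theorem finite_setOf_monic (F : Type) [Field F] [Finite F] (k : ℕ) :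
    {m : F[X] | m.Monic ∧ m.natDegree = k}.Finite := by
  refine (finite_setOf_degree_lt F (k + 1)).subset fun m hm => ?_
  have := degree_le_natDegree (p := m)
  rw [hm.2] at this
  exact this.trans_lt (by exact_mod_cast Nat.lt_succ_self k)

/-- The monic polynomials of degree `k`. -/
def monics (F : Type) [Field F] [Finite F] (k : ℕ) : Finset F[X] :=
  (finite_setOf_monic F k).toFinset

@[simp] theorem mem_monics {k : ℕ} {m : F[X]} : m ∈ monics F k ↔ m.Monic ∧ m.natDegree = k := by
  simp [monics]

theorem sum_polysLT_add {a b : ℕ} {D : F[X]} (hD : D.Monic) (ha : D.natDegree = a)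
    (φ : F[X] → ℂ) :
    ∑ r ∈ polysLT F (a + b), φ r = ∑ w ∈ polysLT F b, ∑ l ∈ polysLT F a, φ (l + D * w) := by
  have hDd : D.degree = a := by rw [degree_eq_natDegree hD.ne_zero, ha]
  rw [← Finset.sum_product']
  symm
  refine Finset.sum_nbij' (fun x => x.2 + D * x.1) (fun r => (r /ₘ D, r %ₘ D)) ?_ ?_ ?_ ?_ ?_
  · rintro ⟨w, l⟩ h
    simp only [Finset.mem_product, mem_polysLT] at h ⊢
    refine (degree_add_le _ _).trans_lt (max_lt (h.2.trans_le (by exact_mod_cast Nat.le_add_right a b)) ?_)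
    rcases eq_or_ne w 0 with rfl | hw
    · simp
    · rw [degree_mul, hDd, degree_eq_natDegree hw]
      have := h.1
      rw [degree_eq_natDegree hw] at this
      norm_cast at this ⊢
      omega
  · intro r h
    simp only [Finset.mem_product, mem_polysLT] at h ⊢
    refine ⟨?_, hDd ▸ degree_modByMonic_lt r hD⟩
    rcases eq_or_ne (r /ₘ D) 0 with h0 | h0
    · rw [h0]; simp
    · have hr : r ≠ 0 := by rintro rfl; simp at h0
      rw [degree_eq_natDegree h0, natDegree_divByMonic r hD, ha]
      have h1 : r.natDegree < a + b := by
        rw [degree_eq_natDegree hr] at h; exact_mod_cast h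
      have h2 : a ≤ r.natDegree := by
        by_contra hlt
        exact h0 ((divByMonic_eq_zero_iff hD).2 (degree_lt_degree (by omega)))
      norm_cast
      omega
  · rintro ⟨w, l⟩ h
    simp only [Finset.mem_product, mem_polysLT] at h
    have := div_modByMonic_unique w l hD ⟨rfl, by rw [hDd]; exact h.2⟩
    simp [this.1, this.2]
  · intro r _
    exact modByMonic_add_div r D
  · intros; rfl

theorem sum_monics (k : ℕ) (φ : F[X] → ℂ) :
    ∑ m ∈ monics F k, φ m = ∑ l ∈ polysLT F k, φ (X ^ k + l) := by
  symm
  refine Finset.sum_nbij' (fun l => X ^ k + l) (fun m => m - X ^ k) ?_ ?_ ?_ ?_ ?_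
  · intro l hl
    rw [mem_polysLT] at hl
    rw [mem_monics]
    refine ⟨monic_X_pow_add hl, ?_⟩
    rw [natDegree_eq_of_degree_eq (degree_add_eq_left_of_degree_lt (by rwa [degree_X_pow])),
      natDegree_X_pow]
  · intro m hm
    rw [mem_monics] at hm
    rw [mem_polysLT]
    have h1 : m.degree = k := by rw [degree_eq_natDegree hm.1.ne_zero, hm.2]
    have := degree_sub_lt_left (p := m) (q := X ^ k) (by rw [h1, degree_X_pow]) hm.1.ne_zero
      (by rw [hm.1.leadingCoeff, leadingCoeff_X_pow])
    rwa [h1] at this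
  · intros; simp
  · intros; simp
  · intros; rfl

theorem sum_polysLT_crt {P Q : F[X]} (hP : P.Monic) (hQ : Q.Monic) (hPQ : IsCoprime P Q)
    (φ : F[X] → ℂ) :
    ∑ r ∈ polysLT F (P.natDegree + Q.natDegree), φ r =
      ∑ x ∈ polysLT F Q.natDegree, ∑ y ∈ polysLT F P.natDegree, φ (P * x + Q * y) := by
  classical
  have hdP := degree_eq_natDegree hP.ne_zero
  have hdQ := degree_eq_natDegree hQ.ne_zero
  set S := polysLT F Q.natDegree ×ˢ polysLT F P.natDegree with hS
  have hinj : Set.InjOn (fun x : F[X] × F[X] => P * x.1 + Q * x.2) S := by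
    rintro ⟨x, y⟩ h ⟨x', y'⟩ h' e
    simp only [hS, Finset.coe_product, Set.mem_prod, Finset.mem_coe, mem_polysLT] at h h' e
    have e1 : P * (x - x') = Q * (y' - y) := by linear_combination e
    have hx : x - x' = 0 := by
      refine eq_zero_of_dvd_of_degree_lt (p := Q) ?_ ?_
      · exact hPQ.symm.dvd_of_dvd_mul_left ⟨_, e1⟩
      · rw [hdQ]; exact (degree_sub_le _ _).trans_lt (max_lt h.1 h'.1)
    have hy : y' - y = 0 := by
      rw [hx, mul_zero] at e1
      exact (mul_eq_zero.1 e1.symm).resolve_left hQ.ne_zero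
    rw [Prod.mk.injEq]
    exact ⟨sub_eq_zero.1 hx, (sub_eq_zero.1 hy).symm⟩
  have himg : S.image (fun x : F[X] × F[X] => P * x.1 + Q * x.2) =
      polysLT F (P.natDegree + Q.natDegree) := by
    -- Surjectivity comes from counting: both sides have `q ^ (deg P + deg Q)` elements.
    refine Finset.eq_of_subset_of_card_le ?_ ?_
    · intro r hr
      obtain ⟨⟨x, y⟩, h, rfl⟩ := Finset.mem_image.1 hr
      simp only [hS, Finset.mem_product, mem_polysLT] at h
      rw [mem_polysLT]
      refine (degree_add_le _ _).trans_lt (max_lt (degree_mul_lt_add hdP h.1) ?_)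
      rw [add_comm]
      exact degree_mul_lt_add hdQ h.2
    · rw [Finset.card_image_of_injOn hinj, hS, Finset.card_product, card_polysLT, card_polysLT,
        card_polysLT, ← pow_add, add_comm]
  rw [← himg, Finset.sum_image hinj, hS, Finset.sum_product]

/-! ### Linear and quadratic exponential sums modulo a monic polynomial -/

variable (ψ : AddChar F ℂ)

open Classical in
/-- The sum of `ψ (res (r l / D))` over `deg l < k`. -/
theorem sum_addChar_resCoeff_mul (hψ : ψ ≠ 1) {D r : F[X]} (hD : D.Monic)
    (hr : r.degree < D.natDegree) (k : ℕ) :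
    ∑ l ∈ polysLT F k, ψ (resCoeff D (r * l)) =
      if r = 0 ∨ r.natDegree + k < D.natDegree then (Nat.card F : ℂ) ^ k else 0 := by
  have hdD := degree_eq_natDegree hD.ne_zero
  split_ifs with h
  · have h1 : ∀ l ∈ polysLT F k, ψ (resCoeff D (r * l)) = 1 := by
      intro l hl
      rw [mem_polysLT] at hl
      rcases eq_or_ne r 0 with rfl | hr0
      · simp
      rcases eq_or_ne l 0 with rfl | hl0
      · simp
      have h := h.resolve_left hr0
      have hl' : l.natDegree < k := by rw [degree_eq_natDegree hl0] at hl; exact_mod_cast hl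
      have hrl : (r * l).natDegree < D.natDegree - 1 := by rw [natDegree_mul hr0 hl0]; omega
      rw [resCoeff_of_degree_lt hD (degree_lt_degree (by omega)),
        coeff_eq_zero_of_natDegree_lt hrl, AddChar.map_zero_eq_one]
    rw [Finset.sum_congr rfl h1, Finset.sum_const, card_polysLT]
    simp
  · push Not at h
    obtain ⟨hr0, h⟩ := h
    have hr' : r.natDegree < D.natDegree := by
      rw [degree_eq_natDegree hr0] at hr; exact_mod_cast hr
    obtain ⟨c, hc⟩ := AddChar.ne_one_iff.1 hψ
    -- The monomial `l₀` is chosen so that `r * l₀` has degree at most `deg D - 1` and residue `c`,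
    -- where `ψ c ≠ 1`. It is admissible since `deg r + k ≥ deg D`, and translating by it multiplies
    -- the sum by `ψ c`.
    set l₀ : F[X] := C (c / r.leadingCoeff) * X ^ (D.natDegree - 1 - r.natDegree) with hl₀
    have hlc : r.leadingCoeff ≠ 0 := leadingCoeff_ne_zero.2 hr0
    have hmul : r * l₀ = C (c / r.leadingCoeff) * (r * X ^ (D.natDegree - 1 - r.natDegree)) := by
      rw [hl₀]; ring
    have hval : resCoeff D (r * l₀) = c := by
      rw [hmul, resCoeff_C_mul, resCoeff_of_degree_lt hD]
      · have : D.natDegree - 1 = r.natDegree + (D.natDegree - 1 - r.natDegree) := by omega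
        conv_lhs => rw [this, add_tsub_cancel_left, coeff_mul_X_pow]
        rw [coeff_natDegree, div_mul_cancel₀ _ hlc]
      · refine degree_lt_degree ?_
        rw [natDegree_mul_X_pow _ hr0]
        omega
    have hl₀k : l₀.degree < k := by
      refine (degree_C_mul_X_pow_le _ _).trans_lt ?_
      norm_cast
      omega
    have hshift : ∑ l ∈ polysLT F k, ψ (resCoeff D (r * l)) =
        ψ c * ∑ l ∈ polysLT F k, ψ (resCoeff D (r * l)) := by
      rw [Finset.mul_sum]
      refine Finset.sum_nbij' (fun l => l - l₀) (fun l => l + l₀) ?_ ?_ ?_ ?_ ?_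
      · intro l hl
        rw [mem_polysLT] at hl ⊢
        exact (degree_sub_le _ _).trans_lt (max_lt hl hl₀k)
      · intro l hl
        rw [mem_polysLT] at hl ⊢
        exact (degree_add_le _ _).trans_lt (max_lt hl hl₀k)
      · intros; simp
      · intros; simp
      · intro l _
        rw [← AddChar.map_add_eq_mul, ← hval, ← resCoeff_add]
        congr 2
        ring
    have : (1 - ψ c) * ∑ l ∈ polysLT F k, ψ (resCoeff D (r * l)) = 0 := by
      linear_combination hshift
    exact (mul_eq_zero.1 this).resolve_left (sub_ne_zero.2 (Ne.symm hc))

theorem sum_polysLT_one [Fintype F] (φ : F[X] → ℂ) :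
    ∑ r ∈ polysLT F 1, φ r = ∑ c : F, φ (C c) := by
  symm
  refine Finset.sum_nbij' (fun c => C c) (fun r => r.coeff 0) ?_ ?_ ?_ ?_ ?_
  · intro c _
    rw [mem_polysLT]
    exact degree_C_le.trans_lt (by norm_num)
  · intros; simp
  · intros; simp
  · intro r hr
    rw [mem_polysLT] at hr
    refine (eq_C_of_degree_le_zero ?_).symm
    exact Order.le_of_lt_succ hr
  · intros; rfl

theorem polysLT_zero : polysLT F 0 = {0} := by
  ext r
  rw [mem_polysLT, Finset.mem_singleton]
  exact ⟨fun h => degree_eq_bot.1 (by simpa using h), by rintro rfl; simp⟩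

/-- The quadratic exponential sum modulo a monic polynomial. -/
theorem sum_addChar_resCoeff_sq [Fintype F] (hψ : ψ ≠ 1) (h2 : (2 : F) ≠ 0)
    (hτ : (∑ c : F, ψ (c ^ 2)) ^ 2 = Nat.card F) {D : F[X]} (hD : D.Monic) :
    ∑ r ∈ polysLT F D.natDegree, ψ (resCoeff D (r ^ 2)) = (∑ c : F, ψ (c ^ 2)) ^ D.natDegree := by
  classical
  set τ := ∑ c : F, ψ (c ^ 2) with hτdef
  set d := D.natDegree with hd
  have hdD : D.degree = d := degree_eq_natDegree hD.ne_zero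
  -- Write `d = 2 k + e` and `r = l + X ^ k * w` with `deg l < k`. Then `l ^ 2` has degree below `d
  -- - 1`, so its residue is zero and the summand is linear in `l`. Orthogonality in `l` leaves only
  -- `deg w < e`, that is, `w = 0` or `w` constant.
  obtain ⟨k, e, he, hke⟩ : ∃ k e, (e = 0 ∨ e = 1) ∧ d = k + (k + e) :=
    ⟨d / 2, d % 2, by omega, by omega⟩
  have hτpow : τ ^ d = (Nat.card F : ℂ) ^ k * τ ^ e := by
    rw [hke, ← hτ]; ring
  have key : ∀ w ∈ polysLT F (k + e), ∑ l ∈ polysLT F k, ψ (resCoeff D ((l + X ^ k * w) ^ 2)) =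
      if w.degree < (e : WithBot ℕ) then (Nat.card F : ℂ) ^ k * ψ (resCoeff D ((X ^ k * w) ^ 2)) else 0 := by
    intro w hw
    rw [mem_polysLT] at hw
    have hw' : (X ^ k * w).degree < (d : WithBot ℕ) := by
      rw [hke]; exact degree_mul_lt_add (degree_X_pow k) hw
    have h1 : ∀ l ∈ polysLT F k, ψ (resCoeff D ((l + X ^ k * w) ^ 2)) =
        ψ (resCoeff D ((X ^ k * w) ^ 2)) * ψ (resCoeff D ((C 2 * (X ^ k * w)) * l)) := by
      intro l hl
      rw [mem_polysLT] at hl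
      have hll : resCoeff D (l ^ 2) = 0 := by
        rcases eq_or_ne l 0 with rfl | hl0
        · simp
        have hl' : l.natDegree < k := by rw [degree_eq_natDegree hl0] at hl; exact_mod_cast hl
        have hlt : (l ^ 2).natDegree < d - 1 := by rw [natDegree_pow]; omega
        rw [resCoeff_of_degree_lt hD (degree_lt_degree (by omega)),
          coeff_eq_zero_of_natDegree_lt hlt]
      have : (l + X ^ k * w) ^ 2 = l ^ 2 + ((X ^ k * w) ^ 2 + (C 2 * (X ^ k * w)) * l) := by
        rw [map_ofNat]; ring
      rw [this, resCoeff_add, hll, zero_add, resCoeff_add, AddChar.map_add_eq_mul]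
    rw [Finset.sum_congr rfl h1, ← Finset.mul_sum, sum_addChar_resCoeff_mul ψ hψ hD
      (by rwa [degree_C_mul h2])]
    have hiff : (C 2 * (X ^ k * w) = 0 ∨ (C 2 * (X ^ k * w)).natDegree + k < D.natDegree) ↔
        w.degree < (e : WithBot ℕ) := by
      rcases eq_or_ne w 0 with rfl | hw0
      · simp
      · rw [natDegree_C_mul h2, natDegree_X_pow_mul _ hw0, degree_eq_natDegree hw0, ← hd]
        simp only [mul_eq_zero, C_eq_zero, h2, hw0, pow_eq_zero_iff', X_ne_zero, false_and,
          or_self, false_or, Nat.cast_lt]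
        omega
    simp only [hiff, mul_ite, mul_zero]
    split_ifs <;> ring
  conv_lhs => rw [hke]
  rw [sum_polysLT_add (monic_X_pow k) (natDegree_X_pow k), Finset.sum_congr rfl key,
    ← Finset.sum_filter]
  have hfil : (polysLT F (k + e)).filter (fun w => w.degree < (e : WithBot ℕ)) = polysLT F e := by
    ext w
    simp only [Finset.mem_filter, mem_polysLT, and_iff_right_iff_imp]
    exact fun h => h.trans_le (by exact_mod_cast Nat.le_add_left e k)
  rw [hfil, ← Finset.mul_sum, hτpow]
  congr 1
  rcases he with rfl | rfl
  · rw [polysLT_zero]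
    simp
  · rw [sum_polysLT_one, pow_one, hτdef]
    refine Finset.sum_congr rfl fun c _ => ?_
    have : (X ^ k * C c) ^ 2 = C (c ^ 2) * X ^ (2 * k) := by
      rw [map_pow]; ring
    rw [this, resCoeff_C_mul, resCoeff_of_degree_lt hD, ← hd, hke]
    · have : k + (k + 1) - 1 = 2 * k := by omega
      rw [this, coeff_X_pow_self, mul_one]
    · rw [degree_X_pow, hdD, hke]
      norm_cast
      omega

end Residues


/-! ### Quadratic Gauss sums over finite fields -/

theorem ringChar_ne_two_of_card {F : Type} [Field F] [Finite F] (hF : Nat.card F % 4 = 1) :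
    ringChar F ≠ 2 := by
  have := Fintype.ofFinite F
  intro h
  have := FiniteField.even_card_of_char_two h
  rw [Nat.card_eq_fintype_card] at hF
  omega

theorem two_ne_zero_of_card {F : Type} [Field F] [Finite F] (hF : Nat.card F % 4 = 1) :
    (2 : F) ≠ 0 :=
  Ring.two_ne_zero (ringChar_ne_two_of_card hF)

open Classical in
-- An element `y` has `χ(y) + 1` square roots, and the `1` contributes nothing because `e` sums to
-- zero.
theorem sum_addChar_sq {K : Type} [Field K] [Fintype K] (hK : ringChar K ≠ 2) (e : AddChar K ℂ)
    (he : ∑ x, e x = 0) : ∑ x, e (x ^ 2) = ∑ x, (quadraticChar K x : ℂ) * e x := by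
  have h1 : ∑ x, e (x ^ 2) = ∑ y, ∑ x with x ^ 2 = y, e (x ^ 2) :=
    (Finset.sum_fiberwise _ _ _).symm
  rw [h1, ← add_zero (∑ x, (quadraticChar K x : ℂ) * e x), ← he, ← Finset.sum_add_distrib]
  refine Finset.sum_congr rfl fun y _ => ?_
  have h2 : ∀ x ∈ Finset.univ.filter (fun x : K => x ^ 2 = y), e (x ^ 2) = e y := by
    intro x hx
    rw [(Finset.mem_filter.1 hx).2]
  have h3 := quadraticChar_card_sqrts hK y
  have h4 : {x : K | x ^ 2 = y}.toFinset = Finset.univ.filter (fun x : K => x ^ 2 = y) := by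
    ext; simp
  rw [h4] at h3
  rw [Finset.sum_congr rfl h2, Finset.sum_const, nsmul_eq_mul, ← Int.cast_natCast, h3]
  push_cast
  ring

section

variable {F : Type} [Field F] [Fintype F] {ψ : AddChar F ℂ}

open Classical in
theorem sum_addChar_sq_eq_gaussSum (hF : Nat.card F % 4 = 1) (hψ : ψ ≠ 1) :
    ∑ c : F, ψ (c ^ 2) =
      gaussSum ((quadraticChar F).ringHomComp (Int.castRingHom ℂ)) ψ := by
  rw [sum_addChar_sq (ringChar_ne_two_of_card hF) ψ (AddChar.sum_eq_zero_of_ne_one hψ)]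
  rfl

/-- The square of the quadratic Gauss sum is `χ(-1) q`, and `χ(-1) = 1` because `q ≡ 1 mod 4`. -/
theorem sum_addChar_sq_sq (hF : Nat.card F % 4 = 1) (hψ : ψ ≠ 1) :
    (∑ c : F, ψ (c ^ 2)) ^ 2 = Nat.card F := by
  classical
  have hr := ringChar_ne_two_of_card hF
  rw [sum_addChar_sq_eq_gaussSum hF hψ, gaussSum_sq _ _ (AddChar.IsPrimitive.of_ne_one hψ)]
  · have h1 : quadraticChar F (-1) = 1 := by
      rw [quadraticChar_neg_one hr, ZMod.χ₄_nat_one_mod_four]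
      rwa [← Nat.card_eq_fintype_card]
    simp [MulChar.ringHomComp_apply, h1]
  · intro h
    obtain ⟨a, ha⟩ := quadraticChar_exists_neg_one' hr
    have := DFunLike.congr_fun h (a : F)
    rw [MulChar.ringHomComp_apply, ha, MulChar.one_apply_coe] at this
    norm_num at this
  · exact (quadraticChar_isQuadratic F).comp _

theorem sum_addChar_sq_ne_zero (hF : Nat.card F % 4 = 1) (hψ : ψ ≠ 1) :
    ∑ c : F, ψ (c ^ 2) ≠ 0 := by
  intro h
  have := sum_addChar_sq_sq hF hψ
  rw [h] at this
  rw [zero_pow two_ne_zero] at this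
  exact Nat.cast_ne_zero.2 Nat.card_pos.ne' this.symm

open Classical in
theorem sum_addChar_mulShift_sq (hF : Nat.card F % 4 = 1) (hψ : ψ ≠ 1) {c : F} (hc : c ≠ 0) :
    ∑ x : F, ψ.mulShift c (x ^ 2) = (quadraticChar F c : ℂ) * ∑ x : F, ψ (x ^ 2) := by
  have h1 : ψ.mulShift c ≠ 1 := AddChar.IsPrimitive.of_ne_one hψ hc
  rw [sum_addChar_sq_eq_gaussSum hF h1, sum_addChar_sq_eq_gaussSum hF hψ]
  have h2 := gaussSum_mulShift ((quadraticChar F).ringHomComp (Int.castRingHom ℂ)) ψ (Units.mk0 c hc)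
  rw [← h2, Units.val_mk0, MulChar.ringHomComp_apply, eq_intCast, ← mul_assoc, ← Int.cast_mul,
    ← pow_two, quadraticChar_sq_one hc, Int.cast_one, one_mul]

end

theorem exists_addChar_ne_one (F : Type) [Field F] [Finite F] : ∃ ψ : AddChar F ℂ, ψ ≠ 1 := by
  obtain ⟨ψ, h⟩ := AddChar.exists_apply_ne_zero.2 (one_ne_zero : (1 : F) ≠ 0)
  exact ⟨ψ, fun h1 => h (by rw [h1]; rfl)⟩

/-! ### Basic properties of the residue symbol -/

section

variable {F : Type} [Field F]

open Classical in
-- Multiplicativity and periodicity of the symbol follow from this comparison with the residue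
-- field.
theorem primeSymbol_eq_quadraticChar (f p : F[X]) [Fact (Irreducible p)] [Fintype (AdjoinRoot p)] :
    primeSymbol f p = quadraticChar (AdjoinRoot p) (AdjoinRoot.mk p f) := by
  rw [quadraticChar_apply, quadraticCharFun, primeSymbol]
  congr 1
  · rw [AdjoinRoot.mk_eq_zero]
  · congr 1
    refine propext ⟨fun ⟨h, hh⟩ => ⟨AdjoinRoot.mk p h, ?_⟩, fun ⟨x, hx⟩ => ?_⟩
    · rw [← map_mul, ← pow_two]
      exact AdjoinRoot.mk_eq_mk.2 hh
    · obtain ⟨h, rfl⟩ := AdjoinRoot.mk_surjective x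
      rw [← map_mul, ← pow_two] at hx
      exact ⟨h, AdjoinRoot.mk_eq_mk.1 hx⟩

theorem primeSymbol_eq_zero {f p : F[X]} (h : p ∣ f) : primeSymbol f p = 0 := by
  rw [primeSymbol, if_pos h]

theorem primeSymbol_sq {f p : F[X]} (h : ¬ p ∣ f) : primeSymbol f p ^ 2 = 1 := by
  rw [primeSymbol, if_neg h]
  split_ifs <;> norm_num

theorem primeSymbol_one {p : F[X]} (hp : Irreducible p) : primeSymbol 1 p = 1 := by
  rw [primeSymbol, if_neg hp.not_dvd_one, if_pos ⟨1, by simp⟩]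

@[simp] theorem residueSymbol_one_right (f : F[X]) : residueSymbol f 1 = 1 := by
  classical simp [residueSymbol]

@[simp] theorem residueSymbol_one_left (g : F[X]) : residueSymbol 1 g = 1 := by
  classical
  rw [residueSymbol]
  refine Multiset.prod_eq_one fun x hx => ?_
  obtain ⟨p, hp, rfl⟩ := Multiset.mem_map.1 hx
  exact primeSymbol_one (UniqueFactorizationMonoid.irreducible_of_normalized_factor p hp)

theorem residueSymbol_mul_right (f : F[X]) {g h : F[X]} (hg : g ≠ 0) (hh : h ≠ 0) :
    residueSymbol f (g * h) = residueSymbol f g * residueSymbol f h := by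
  classical
  rw [residueSymbol, UniqueFactorizationMonoid.normalizedFactors_mul hg hh, Multiset.map_add,
    Multiset.prod_add, residueSymbol, residueSymbol]

theorem residueSymbol_prime (f : F[X]) {p : F[X]} (hp : IsPrimePoly p) :
    residueSymbol f p = primeSymbol f p := by
  classical
  rw [residueSymbol, UniqueFactorizationMonoid.normalizedFactors_irreducible hp.2,
    hp.1.normalize_eq_self]
  simp

theorem residueSymbol_pow_right (f : F[X]) {g : F[X]} (hg : g ≠ 0) (k : ℕ) :
    residueSymbol f (g ^ k) = residueSymbol f g ^ k := by
  induction k with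
  | zero => simp
  | succ k ih => rw [pow_succ, residueSymbol_mul_right f (pow_ne_zero k hg) hg, ih, pow_succ]

theorem residueSymbol_eq_zero {f g p : F[X]} (hp : IsPrimePoly p) (hg : g ≠ 0) (h1 : p ∣ f)
    (h2 : p ∣ g) : residueSymbol f g = 0 := by
  obtain ⟨g', rfl⟩ := h2
  rw [residueSymbol_mul_right _ (left_ne_zero_of_mul hg) (right_ne_zero_of_mul hg),
    residueSymbol_prime f hp, primeSymbol_eq_zero h1, zero_mul]

/-- Induction on the number of prime factors of a monic polynomial. -/
theorem monic_induction {motive : ∀ f : F[X], f.Monic → Prop} (one : motive 1 monic_one)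
    (mul : ∀ p g, ∀ hp : IsPrimePoly p, ∀ hg : g.Monic, motive g hg →
      motive (p * g) (hp.1.mul hg)) (f : F[X]) (hf : f.Monic) : motive f hf := by
  induction hn : f.natDegree using Nat.strong_induction_on generalizing f with
  | _ n ih =>
    by_cases hu : IsUnit f
    · obtain rfl := hf.isUnit_iff.1 hu
      exact one
    · obtain ⟨p, hp, hpi, g, rfl⟩ := exists_monic_irreducible_factor f hu
      have hg : g.Monic := hp.of_mul_monic_left hf
      refine mul p g ⟨hp, hpi⟩ hg (ih _ ?_ g hg rfl)
      have := hpi.natDegree_pos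
      rw [hp.natDegree_mul hg] at hn
      omega

theorem residueSymbol_sq {f g : F[X]} (hg : g.Monic) (h : IsCoprime f g) :
    residueSymbol f g ^ 2 = 1 := by
  induction g, hg using monic_induction with
  | one => simp
  | mul p g hp hg ih =>
    rw [residueSymbol_mul_right _ hp.1.ne_zero hg.ne_zero, mul_pow,
      ih (IsCoprime.of_mul_right_right h), residueSymbol_prime f hp, primeSymbol_sq, one_mul]
    intro hd
    exact hp.2.not_isUnit ((IsCoprime.of_mul_right_left h).isUnit_of_dvd' hd dvd_rfl)

theorem resCoeff_mul_right {P Q : F[X]} (hP : P.Monic) (hQ : Q.Monic) (r : F[X]) :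
    resCoeff (P * Q) (Q * r) = resCoeff P r := by
  rw [mul_comm P, resCoeff_mul_left hQ hP]

theorem resCoeff_mul_mul {P Q : F[X]} (hP : P.Monic) (hQ : Q.Monic) (r : F[X]) :
    resCoeff (P * Q) (P * Q * r) = 0 := by
  rw [resCoeff, (modByMonic_eq_zero_iff_dvd (hP.mul hQ)).2 (dvd_mul_right _ _), coeff_zero]

theorem IsPrimePoly.isCoprime {P : F[X]} (hP : IsPrimePoly P) {a : F[X]} (h : ¬ P ∣ a) :
    IsCoprime P a :=
  hP.2.coprime_iff_not_dvd.2 h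

theorem IsPrimePoly.eq_of_dvd {P Q : F[X]} (hP : IsPrimePoly P) (hQ : IsPrimePoly Q) (h : P ∣ Q) :
    P = Q :=
  eq_of_monic_of_associated hP.1 hQ.1 (hP.2.associated_of_dvd hQ.2 h)

/-- The additive character `x ↦ ψ (res (x / P))` of `F[t] / P`. -/
def quotAddChar (ψ : AddChar F ℂ) {P : F[X]} (hP : P.Monic) : AddChar (AdjoinRoot P) ℂ :=
  ψ.compAddMonoidHom
    ((lcoeff F (P.natDegree - 1)).comp (AdjoinRoot.modByMonicHom hP)).toAddMonoidHom

theorem quotAddChar_mk {ψ : AddChar F ℂ} {P : F[X]} (hP : P.Monic) (r : F[X]) :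
    quotAddChar ψ hP (AdjoinRoot.mk P r) = ψ (resCoeff P r) := by
  simp [quotAddChar, resCoeff, AdjoinRoot.modByMonicHom_mk]

end

section

variable {F : Type} [Field F] [Finite F]

theorem finite_adjoinRoot {p : F[X]} (hp : p ≠ 0) : Finite (AdjoinRoot p) :=
  have : Module.Finite F (AdjoinRoot p) := (AdjoinRoot.powerBasis hp).finite
  Module.finite_of_finite F

theorem primeSymbol_mul {p : F[X]} (hp : Irreducible p) (f g : F[X]) :
    primeSymbol (f * g) p = primeSymbol f p * primeSymbol g p := by
  have := Fact.mk hp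
  have := finite_adjoinRoot hp.ne_zero
  have := Fintype.ofFinite (AdjoinRoot p)
  simp only [primeSymbol_eq_quadraticChar, map_mul]

theorem primeSymbol_congr {p : F[X]} (hp : Irreducible p) {f g : F[X]} (h : p ∣ f - g) :
    primeSymbol f p = primeSymbol g p := by
  have := Fact.mk hp
  have := finite_adjoinRoot hp.ne_zero
  have := Fintype.ofFinite (AdjoinRoot p)
  simp only [primeSymbol_eq_quadraticChar, AdjoinRoot.mk_eq_mk.2 h]

end

section

variable {F : Type} [Field F] [Finite F]

theorem residueSymbol_mul_left (f g h : F[X]) :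
    residueSymbol (f * g) h = residueSymbol f h * residueSymbol g h := by
  classical
  rw [residueSymbol, residueSymbol, residueSymbol, ← Multiset.prod_map_mul]
  congr 1
  exact Multiset.map_congr rfl fun p hp =>
    primeSymbol_mul (UniqueFactorizationMonoid.irreducible_of_normalized_factor p hp) f g

theorem residueSymbol_pow_left (f g : F[X]) (k : ℕ) :
    residueSymbol (f ^ k) g = residueSymbol f g ^ k := by
  induction k with
  | zero => simp
  | succ k ih => rw [pow_succ, residueSymbol_mul_left, ih, pow_succ]

theorem residueSymbol_congr {f g h : F[X]} (hd : h ∣ f - g) :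
    residueSymbol f h = residueSymbol g h := by
  classical
  rw [residueSymbol, residueSymbol]
  congr 1
  exact Multiset.map_congr rfl fun p hp =>
    primeSymbol_congr (UniqueFactorizationMonoid.irreducible_of_normalized_factor p hp)
      ((UniqueFactorizationMonoid.dvd_of_mem_normalizedFactors hp).trans hd)

end

/-! ### Gauss sums over `F[t]` and quadratic reciprocity -/

section

variable {F : Type} [Field F] [Fintype F] {ψ : AddChar F ℂ}

theorem sum_polysLT_mk {P : F[X]} (hP : P.Monic) [Fintype (AdjoinRoot P)]
    (g : AdjoinRoot P → ℂ) :
    ∑ r ∈ polysLT F P.natDegree, g (AdjoinRoot.mk P r) = ∑ x, g x := by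
  have hd := degree_eq_natDegree hP.ne_zero
  refine Finset.sum_nbij' (fun r => AdjoinRoot.mk P r) (fun x => AdjoinRoot.modByMonicHom hP x)
    ?_ ?_ ?_ ?_ ?_
  · intros; simp
  · intro x _
    obtain ⟨r, rfl⟩ := AdjoinRoot.mk_surjective x
    rw [AdjoinRoot.modByMonicHom_mk, mem_polysLT, ← hd]
    exact degree_modByMonic_lt r hP
  · intro r hr
    rw [mem_polysLT, ← hd] at hr
    rw [AdjoinRoot.modByMonicHom_mk, (modByMonic_eq_self_iff hP).2 hr]
  · intro x _
    exact AdjoinRoot.mk_leftInverse hP x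
  · intros; rfl

theorem sum_quotAddChar (hψ : ψ ≠ 1) {P : F[X]} (hP : IsPrimePoly P) [Fintype (AdjoinRoot P)] :
    ∑ x, quotAddChar ψ hP.1 x = 0 := by
  have hpos := hP.2.natDegree_pos
  have h := sum_addChar_resCoeff_mul ψ hψ hP.1 (r := 1)
    (by rw [degree_one]; exact_mod_cast hpos) P.natDegree
  rw [if_neg (by simp)] at h
  rw [← sum_polysLT_mk hP.1, ← h]
  simp only [quotAddChar_mk, one_mul]

theorem sum_quotAddChar_sq (hF : Nat.card F % 4 = 1) (hψ : ψ ≠ 1) {P : F[X]} (hP : IsPrimePoly P)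
    {a : F[X]} (ha : ¬ P ∣ a) :
    ∑ r ∈ polysLT F P.natDegree, ψ (resCoeff P (a * r ^ 2)) =
      ∑ r ∈ polysLT F P.natDegree, (primeSymbol r P : ℂ) * ψ (resCoeff P (a * r)) := by
  classical
  have := Fact.mk hP.2
  have := finite_adjoinRoot hP.2.ne_zero
  have := Fintype.ofFinite (AdjoinRoot P)
  have ha0 : AdjoinRoot.mk P a ≠ 0 := by rwa [Ne, AdjoinRoot.mk_eq_zero]
  have hK : ringChar (AdjoinRoot P) ≠ 2 := by
    rw [← Algebra.ringChar_eq F]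
    exact ringChar_ne_two_of_card hF
  have h0 : ∑ x, (quotAddChar ψ hP.1).mulShift (AdjoinRoot.mk P a) x = 0 := by
    rw [← sum_quotAddChar hψ hP]
    exact Fintype.sum_equiv (Equiv.mulLeft₀ _ ha0) _ _ fun x => rfl
  have h := sum_addChar_sq hK _ h0
  rw [← sum_polysLT_mk hP.1, ← sum_polysLT_mk hP.1] at h
  simpa only [AddChar.mulShift_apply, ← map_pow, ← map_mul, quotAddChar_mk,
    ← primeSymbol_eq_quadraticChar] using h

/-- For `m` prime to `P`, the substitution `r ↦ m r` extracts `(m / P)` and leaves the sum with `m =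
1`. Counting square roots in the residue field turns that one into the quadratic exponential sum
modulo `P`, which is known. If `P` divides `m`, the nontrivial character sums to zero. -/
theorem sum_primeSymbol_mul_addChar (hF : Nat.card F % 4 = 1) (hψ : ψ ≠ 1) {P : F[X]}
    (hP : IsPrimePoly P) (m : F[X]) :
    ∑ r ∈ polysLT F P.natDegree, (primeSymbol r P : ℂ) * ψ (resCoeff P (m * r)) =
      primeSymbol m P * (∑ c : F, ψ (c ^ 2)) ^ P.natDegree := by
  classical
  have := Fact.mk hP.2
  have := finite_adjoinRoot hP.2.ne_zero
  have := Fintype.ofFinite (AdjoinRoot P)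
  have hK : ringChar (AdjoinRoot P) ≠ 2 := by
    rw [← Algebra.ringChar_eq F]
    exact ringChar_ne_two_of_card hF
  have key : ∀ m, ∑ r ∈ polysLT F P.natDegree, (primeSymbol r P : ℂ) * ψ (resCoeff P (m * r)) =
      ∑ x, (quadraticChar (AdjoinRoot P) x : ℂ) *
        (quotAddChar ψ hP.1).mulShift (AdjoinRoot.mk P m) x := by
    intro m
    rw [← sum_polysLT_mk hP.1]
    simp only [AddChar.mulShift_apply, ← map_mul, quotAddChar_mk, ← primeSymbol_eq_quadraticChar]
  by_cases hm : P ∣ m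
  · rw [key, AdjoinRoot.mk_eq_zero.2 hm, primeSymbol_eq_zero hm]
    have := quadraticChar_sum_zero hK
    simp only [AddChar.mulShift_zero, AddChar.one_apply, mul_one, Int.cast_zero, zero_mul]
    rw [← Int.cast_sum, this, Int.cast_zero]
  · have h1 := sum_quotAddChar_sq hF hψ hP hP.2.not_dvd_one
    simp only [one_mul] at h1
    rw [sum_addChar_resCoeff_sq ψ hψ (two_ne_zero_of_card hF) (sum_addChar_sq_sq hF hψ) hP.1] at h1
    have h1' := key 1
    simp only [one_mul] at h1'
    rw [key, h1, h1', map_one, AddChar.mulShift_one]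
    have hm0 : AdjoinRoot.mk P m ≠ 0 := by rwa [Ne, AdjoinRoot.mk_eq_zero]
    rw [← Equiv.sum_comp (Equiv.mulLeft₀ _ hm0) fun y =>
      (quadraticChar (AdjoinRoot P) y : ℂ) * quotAddChar ψ hP.1 y, Finset.mul_sum]
    refine Finset.sum_congr rfl fun x _ => ?_
    rw [Equiv.mulLeft₀_apply, map_mul, AddChar.mulShift_apply, ← primeSymbol_eq_quadraticChar]
    have := primeSymbol_sq hm
    have h2 : (primeSymbol m P : ℂ) ^ 2 = 1 := by exact_mod_cast this
    push_cast
    linear_combination (-(quadraticChar (AdjoinRoot P) x : ℂ) *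
      quotAddChar ψ hP.1 (AdjoinRoot.mk P m * x)) * h2

end

section

variable {F : Type} [Field F] [Finite F]

/-- The quadratic exponential sum modulo `D` is `τ ^ deg D`, hence multiplicative in `D`. The
Chinese remainder theorem computes it modulo `P Q` as the product of the sums modulo `P` and `Q`,
times `(P / Q) (Q / P)`. As `τ ≠ 0`, this factor is `1`. -/
theorem primeSymbol_reciprocity (hF : Nat.card F % 4 = 1) {P Q : F[X]} (hP : IsPrimePoly P)
    (hQ : IsPrimePoly Q) : primeSymbol P Q = primeSymbol Q P := by
  rcases eq_or_ne P Q with rfl | hne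
  · rfl
  have := Fintype.ofFinite F
  obtain ⟨ψ, hψ⟩ := exists_addChar_ne_one F
  have hPQ : ¬ P ∣ Q := fun h => hne (hP.eq_of_dvd hQ h)
  have hQP : ¬ Q ∣ P := fun h => hne (hQ.eq_of_dvd hP h).symm
  set τ := ∑ c : F, ψ (c ^ 2) with hτ
  have hτ0 : τ ≠ 0 := sum_addChar_sq_ne_zero hF hψ
  have h1 := sum_addChar_resCoeff_sq ψ hψ (two_ne_zero_of_card hF) (sum_addChar_sq_sq hF hψ)
    (hP.1.mul hQ.1)
  rw [hP.1.natDegree_mul hQ.1, sum_polysLT_crt hP.1 hQ.1 (hP.isCoprime hPQ), ← hτ] at h1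
  have h2 : ∀ x y, ψ (resCoeff (P * Q) ((P * x + Q * y) ^ 2)) =
      ψ (resCoeff Q (P * x ^ 2)) * ψ (resCoeff P (Q * y ^ 2)) := by
    intro x y
    have : (P * x + Q * y) ^ 2 =
        P * (P * x ^ 2) + (Q * (Q * y ^ 2) + P * Q * (C 2 * x * y)) := by
      rw [map_ofNat]; ring
    rw [this, resCoeff_add, resCoeff_add, resCoeff_mul_mul hP.1 hQ.1, resCoeff_mul_left hP.1 hQ.1,
      resCoeff_mul_right hP.1 hQ.1, add_zero, AddChar.map_add_eq_mul]
  simp only [h2, ← Finset.mul_sum, ← Finset.sum_mul] at h1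
  rw [sum_quotAddChar_sq hF hψ hP hPQ, sum_quotAddChar_sq hF hψ hQ hQP,
    sum_primeSymbol_mul_addChar hF hψ hP, sum_primeSymbol_mul_addChar hF hψ hQ, ← hτ] at h1
  have h3 : (primeSymbol P Q : ℂ) * primeSymbol Q P = 1 := by
    refine mul_right_cancel₀ (pow_ne_zero (P.natDegree + Q.natDegree) hτ0) ?_
    linear_combination h1
  have h4 : primeSymbol P Q * primeSymbol Q P = 1 := by exact_mod_cast h3
  have h5 := primeSymbol_sq hPQ
  linear_combination primeSymbol Q P * h4 - primeSymbol P Q * h5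

theorem residueSymbol_reciprocity (hF : Nat.card F % 4 = 1) {f g : F[X]} (hf : f.Monic)
    (hg : g.Monic) : residueSymbol f g = residueSymbol g f := by
  have key : ∀ p, IsPrimePoly p → residueSymbol p g = residueSymbol g p := by
    intro p hp
    clear hf
    induction g, hg using monic_induction with
    | one => simp
    | mul r g hr hg ih =>
      rw [residueSymbol_mul_right _ hr.1.ne_zero hg.ne_zero, residueSymbol_mul_left, ih,
        residueSymbol_prime p hr, residueSymbol_prime r hp, primeSymbol_reciprocity hF hp hr]
  induction f, hf using monic_induction with
  | one => simp
  | mul p f hp hf ih =>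
    rw [residueSymbol_mul_right _ hp.1.ne_zero hf.ne_zero, residueSymbol_mul_left, ih, key p hp]

end

section

variable {F : Type} [Field F] [Fintype F] {ψ : AddChar F ℂ}

/-- The Gauss sum of the residue symbol modulo a squarefree monic polynomial. -/
theorem sum_residueSymbol_mul_addChar (hF : Nat.card F % 4 = 1) (hψ : ψ ≠ 1) {D : F[X]}
    (hD : D.Monic) (hsq : Squarefree D) (m : F[X]) :
    ∑ r ∈ polysLT F D.natDegree, (residueSymbol r D : ℂ) * ψ (resCoeff D (m * r)) =
      residueSymbol m D * (∑ c : F, ψ (c ^ 2)) ^ D.natDegree := by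
  induction D, hD using monic_induction with
  | one => simp [polysLT_zero]
  | mul P Q hP hQ ih =>
    have hdvd : ¬ P ∣ Q := fun ⟨s, hs⟩ =>
      hP.2.not_isUnit (hsq P ⟨s, by rw [hs, mul_assoc]⟩)
    have hcop := hP.isCoprime hdvd
    -- This is the cross factor from the Chinese remainder theorem, and reciprocity removes it.
    have h1 : (residueSymbol P Q : ℂ) * residueSymbol Q P = 1 := by
      rw [residueSymbol_reciprocity hF hQ hP.1, ← pow_two]
      exact_mod_cast residueSymbol_sq hQ hcop
    have h2 : ∀ x y, (residueSymbol (P * x + Q * y) (P * Q) : ℂ) *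
        ψ (resCoeff (P * Q) (m * (P * x + Q * y))) =
        ((residueSymbol x Q : ℂ) * ψ (resCoeff Q (m * x))) *
          ((residueSymbol y P : ℂ) * ψ (resCoeff P (m * y))) := by
      intro x y
      have e1 : residueSymbol (P * x + Q * y) P = residueSymbol Q P * residueSymbol y P := by
        rw [← residueSymbol_mul_left]
        exact residueSymbol_congr ⟨x, by ring⟩
      have e2 : residueSymbol (P * x + Q * y) Q = residueSymbol P Q * residueSymbol x Q := by
        rw [← residueSymbol_mul_left]
        exact residueSymbol_congr ⟨y, by ring⟩
      have e3 : m * (P * x + Q * y) = P * (m * x) + Q * (m * y) := by ring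
      rw [residueSymbol_mul_right _ hP.1.ne_zero hQ.ne_zero, e1, e2, e3, resCoeff_add,
        resCoeff_mul_left hP.1 hQ, resCoeff_mul_right hP.1 hQ, AddChar.map_add_eq_mul]
      push_cast
      linear_combination ((residueSymbol x Q : ℂ) * ψ (resCoeff Q (m * x)) *
          ((residueSymbol y P : ℂ) * ψ (resCoeff P (m * y)))) * h1
    rw [hP.1.natDegree_mul hQ, sum_polysLT_crt hP.1 hQ hcop]
    simp only [h2, ← Finset.mul_sum, ← Finset.sum_mul]
    rw [ih (hsq.squarefree_of_dvd (dvd_mul_left _ _)),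
      residueSymbol_mul_right _ hP.1.ne_zero hQ.ne_zero, residueSymbol_prime m hP]
    simp only [residueSymbol_prime _ hP]
    rw [sum_primeSymbol_mul_addChar hF hψ hP]
    push_cast
    ring

open Classical in
-- The Gauss sum modulo `D` is evaluated in two ways: at `m = c` with the character `ψ`, and at `m =
-- 1` with `x ↦ ψ (c x)`. In the second, `τ` is replaced by `χ(c) τ`.
theorem residueSymbol_C (hF : Nat.card F % 4 = 1) {D : F[X]} (hD : D.Monic) (hsq : Squarefree D)
    {c : F} (hc : c ≠ 0) :
    residueSymbol (C c) D = quadraticChar F c ^ D.natDegree := by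
  obtain ⟨ψ, hψ⟩ := exists_addChar_ne_one F
  have h1 := sum_residueSymbol_mul_addChar hF hψ hD hsq (C c)
  have h2 := sum_residueSymbol_mul_addChar hF
    (AddChar.IsPrimitive.of_ne_one hψ hc) hD hsq 1
  rw [sum_addChar_mulShift_sq hF hψ hc] at h2
  simp only [resCoeff_C_mul, AddChar.mulShift_apply, one_mul, residueSymbol_one_left] at h1 h2
  rw [h1] at h2
  have h3 : (residueSymbol (C c) D : ℂ) = (quadraticChar F c : ℂ) ^ D.natDegree := by
    refine mul_right_cancel₀ (pow_ne_zero D.natDegree (sum_addChar_sq_ne_zero hF hψ)) ?_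
    rw [h2]
    push_cast
    ring
  exact_mod_cast h3

end


/-! ### Self-reciprocal power series -/

/-- The power series `φ` is a polynomial `P` of degree at most `2 m` with
`(q x ^ 2) ^ m P(1 / (q x)) = P(x)`. -/
structure IsPal {R : Type*} [CommRing R] (q : R) (m : ℕ) (φ : PowerSeries R) : Prop where
  coeff_symm : ∀ k l, k + l = 2 * m →
    q ^ k * PowerSeries.coeff l φ = q ^ m * PowerSeries.coeff k φ
  coeff_eq_zero : ∀ k, 2 * m < k → PowerSeries.coeff k φ = 0

theorem IsPal.map {R S : Type*} [CommRing R] [CommRing S] (f : R →+* S) {q : R} {m : ℕ}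
    {φ : PowerSeries R} (h : IsPal q m φ) : IsPal (f q) m (PowerSeries.map f φ) := by
  refine ⟨fun k l hkl => ?_, fun k hk => ?_⟩
  · rw [PowerSeries.coeff_map, PowerSeries.coeff_map, ← map_pow, ← map_pow, ← map_mul, ← map_mul,
      h.coeff_symm k l hkl]
  · rw [PowerSeries.coeff_map, h.coeff_eq_zero k hk, map_zero]

theorem IsPal.exists_polynomial {q : ℂ} {m : ℕ} {φ : PowerSeries ℂ} (h : IsPal q m φ) :
    ∃ P : ℂ[X], (P : PowerSeries ℂ) = φ ∧ P.natDegree ≤ 2 * m := by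
  refine ⟨PowerSeries.trunc (2 * m + 1) φ, ?_, ?_⟩
  · ext k
    rw [coeff_coe, PowerSeries.coeff_trunc]
    split_ifs with hk
    · rfl
    · exact (h.coeff_eq_zero k (by omega)).symm
  · exact Nat.lt_succ_iff.1 (PowerSeries.natDegree_trunc_lt φ (2 * m))

theorem IsPal.natDegree_le {q : ℂ} {m : ℕ} {P : ℂ[X]} (h : IsPal q m (P : PowerSeries ℂ)) :
    P.natDegree ≤ 2 * m := by
  rw [natDegree_le_iff_coeff_eq_zero]
  intro k hk
  rw [← coeff_coe]
  exact h.coeff_eq_zero k hk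

/-- The point `x` may lie in any field over `ℂ`: in `ℂ` this gives the criterion `isPal_coe_iff`,
and at the variable of `RatFunc ℂ` it gives the functional equation itself. -/
theorem IsPal.aeval {K : Type*} [Field K] [Algebra ℂ K] {q : ℂ} (hq : q ≠ 0) {m : ℕ} {P : ℂ[X]}
    (h : IsPal q m (P : PowerSeries ℂ)) {x : K} (hx : x ≠ 0) :
    (algebraMap ℂ K q * x ^ 2) ^ m * aeval (algebraMap ℂ K q * x)⁻¹ P = aeval x P := by
  have hd : P.natDegree < 2 * m + 1 := Nat.lt_succ_iff.2 h.natDegree_le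
  have hq' : algebraMap ℂ K q ≠ 0 := by simpa using hq
  rw [aeval_eq_sum_range' hd, aeval_eq_sum_range' hd, Finset.mul_sum, ← Finset.sum_range_reflect]
  refine Finset.sum_congr rfl fun k hk => ?_
  rw [Finset.mem_range] at hk
  have h1 : 2 * m + 1 - 1 - k + k = 2 * m := by omega
  generalize 2 * m + 1 - 1 - k = l at h1
  have h2 := h.coeff_symm k l (by omega)
  rw [coeff_coe, coeff_coe] at h2
  have h3 := congrArg (algebraMap ℂ K) h2
  rw [map_mul, map_mul, map_pow, map_pow] at h3
  rw [Algebra.smul_def, Algebra.smul_def]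
  set Q := algebraMap ℂ K q
  have hQ : Q ^ (l + k) = Q ^ m * Q ^ m := by rw [h1, two_mul, pow_add]
  have hX : x ^ (l + k) = (x ^ 2) ^ m := by rw [h1, pow_mul]
  rw [pow_add] at hQ hX
  rw [inv_pow, mul_pow, mul_pow, ← hX, ← div_eq_mul_inv, ← mul_div_assoc, div_eq_iff (by positivity)]
  have : Q ^ m ≠ 0 := pow_ne_zero m hq'
  have h5 : Q ^ m * algebraMap ℂ K (P.coeff l) = Q ^ l * algebraMap ℂ K (P.coeff k) := by
    refine mul_left_cancel₀ this ?_
    linear_combination (-algebraMap ℂ K (P.coeff l)) * hQ + Q ^ l * h3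
  linear_combination x ^ l * x ^ k * h5

/-- The coefficient form makes sense over `ℂ[X]`, where `q` becomes an indeterminate, and is stable
under sums. The evaluated form makes products and substitutions immediate. -/
theorem isPal_coe_iff {q : ℂ} (hq : q ≠ 0) {m : ℕ} {P : ℂ[X]} :
    IsPal q m (P : PowerSeries ℂ) ↔ P.natDegree ≤ 2 * m ∧
      ∀ x, x ≠ 0 → (q * x ^ 2) ^ m * P.eval (q * x)⁻¹ = P.eval x := by
  refine ⟨fun h => ⟨h.natDegree_le, fun x hx => ?_⟩, fun ⟨hd, h⟩ => ?_⟩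
  · simpa using h.aeval hq hx
  -- `R` is the reversed polynomial `(q x ^ 2) ^ m P(1 / (q x))`. It agrees with `P` at all nonzero
  -- points, hence as a polynomial.
  · set R : ℂ[X] := ∑ k ∈ Finset.range (2 * m + 1),
      C (q ^ m * P.coeff (2 * m - k) * (q ^ (2 * m - k))⁻¹) * X ^ k with hR
    have hRP : R = P := by
      refine Polynomial.eq_of_infinite_eval_eq _ _ ((Set.finite_singleton (0 : ℂ)).infinite_compl.mono ?_)
      intro x hx
      have hx : x ≠ 0 := hx
      rw [Set.mem_ofPred_eq, ← h x hx, hR, eval_finsetSum,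
        eval_eq_sum_range' (Nat.lt_succ_iff.2 hd), Finset.mul_sum, ← Finset.sum_range_reflect]
      refine Finset.sum_congr rfl fun k hk => ?_
      rw [Finset.mem_range] at hk
      have h1 : 2 * m + 1 - 1 - k + k = 2 * m := by omega
      have h2 : 2 * m - (2 * m + 1 - 1 - k) = k := by omega
      rw [h2]
      generalize 2 * m + 1 - 1 - k = l at h1
      have hX : x ^ (l + k) = (x ^ 2) ^ m := by rw [h1, pow_mul]
      rw [pow_add] at hX
      rw [mul_pow, ← hX]
      simp only [eval_mul, eval_C, eval_pow, eval_X]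
      rw [inv_pow, mul_pow q x k]
      field_simp
    have hc : ∀ k, k ≤ 2 * m → P.coeff k = q ^ m * P.coeff (2 * m - k) * (q ^ (2 * m - k))⁻¹ := by
      intro k hk
      conv_lhs => rw [← hRP, hR]
      simp only [finsetSum_coeff, coeff_C_mul, coeff_X_pow, mul_ite, mul_one, mul_zero,
        Finset.sum_ite_eq, Finset.mem_range]
      rw [if_pos (by omega)]
    refine ⟨fun k l hkl => ?_, fun k hk => ?_⟩
    · rw [coeff_coe, coeff_coe, hc l (by omega)]
      have : 2 * m - l = k := by omega
      rw [this]
      field_simp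
    · rw [coeff_coe]
      exact coeff_eq_zero_of_natDegree_lt (by omega)

theorem IsPal.mul {q : ℂ} (hq : q ≠ 0) {m m' : ℕ} {φ φ' : PowerSeries ℂ} (h : IsPal q m φ)
    (h' : IsPal q m' φ') : IsPal q (m + m') (φ * φ') := by
  obtain ⟨P, rfl, -⟩ := h.exists_polynomial
  obtain ⟨P', rfl, -⟩ := h'.exists_polynomial
  rw [isPal_coe_iff hq] at h h'
  rw [← coe_mul, isPal_coe_iff hq]
  refine ⟨natDegree_mul_le.trans (by omega), fun x hx => ?_⟩
  rw [eval_mul, eval_mul, ← h.2 x hx, ← h'.2 x hx]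
  ring

/-- With `y = ε x ^ d` and `ε⁻¹ = ε`, the inversion `x ↦ 1 / (q x)` induces `y ↦ 1 / (q ^ d y)`. -/
theorem IsPal.comp {q : ℂ} (hq : q ≠ 0) {m d : ℕ} {P : ℂ[X]} {ε : ℂ} (hε : ε ^ 2 = 1)
    (h : IsPal (q ^ d) m (P : PowerSeries ℂ)) :
    IsPal q (m * d) ((P.comp (C ε * X ^ d) : ℂ[X]) : PowerSeries ℂ) := by
  have hε0 : ε ≠ 0 := by rintro rfl; norm_num at hε
  rw [isPal_coe_iff (pow_ne_zero d hq)] at h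
  rw [isPal_coe_iff hq]
  refine ⟨?_, fun x hx => ?_⟩
  · refine natDegree_comp_le.trans ?_
    rw [← mul_assoc]
    exact Nat.mul_le_mul h.1 (natDegree_C_mul_X_pow_le ε d)
  · have h1 := h.2 (ε * x ^ d) (mul_ne_zero hε0 (pow_ne_zero d hx))
    have h2 : ε * ((q * x)⁻¹) ^ d = (q ^ d * (ε * x ^ d))⁻¹ := by
      have h3 : ε⁻¹ = ε := inv_eq_of_mul_eq_one_left (by rw [← pow_two, hε])
      rw [inv_pow, mul_pow, ← mul_left_comm, mul_inv, mul_inv, mul_inv, h3]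
    simp only [eval_comp, eval_mul, eval_C, eval_pow, eval_X]
    rw [← h1, h2, mul_pow ε, hε]
    ring

theorem IsPal.sum {ι : Type*} {q : ℂ} {m : ℕ} (s : Finset ι) {φ : ι → PowerSeries ℂ}
    (h : ∀ i ∈ s, IsPal q m (φ i)) : IsPal q m (∑ i ∈ s, φ i) := by
  refine ⟨fun k l hkl => ?_, fun k hk => ?_⟩
  · rw [map_sum, map_sum, Finset.mul_sum, Finset.mul_sum]
    exact Finset.sum_congr rfl fun i hi => (h i hi).coeff_symm k l hkl
  · rw [map_sum]
    exact Finset.sum_eq_zero fun i hi => (h i hi).coeff_eq_zero k hk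

theorem IsPal.C_mul {q : ℂ} {m : ℕ} {φ : PowerSeries ℂ} (h : IsPal q m φ) (c : ℂ) :
    IsPal q m (PowerSeries.C c * φ) := by
  refine ⟨fun k l hkl => ?_, fun k hk => ?_⟩
  · rw [PowerSeries.coeff_C_mul, PowerSeries.coeff_C_mul]
    linear_combination c * h.coeff_symm k l hkl
  · rw [PowerSeries.coeff_C_mul, h.coeff_eq_zero k hk, mul_zero]

/-! ### Numerators of `L`-series and the shape of their functional equation -/

/-- The numerator of a series with a functional equation of conductor degree `N`. -/
def numer {R : Type*} [CommRing R] (q : R) (N : ℕ) (φ : PowerSeries R) : PowerSeries R :=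
  if N % 2 = 1 then φ else (1 - PowerSeries.C q * PowerSeries.X) * φ

theorem map_numer {R S : Type*} [CommRing R] [CommRing S] (f : R →+* S) (q : R) (N : ℕ)
    (φ : PowerSeries R) :
    PowerSeries.map f (numer q N φ) = numer (f q) N (PowerSeries.map f φ) := by
  rw [numer, numer]
  split_ifs with h
  · rfl
  · simp

/-- The functional equation of an `L`-series of conductor degree `N`. -/
def HasFE (q : ℂ) (N : ℕ) (φ : PowerSeries ℂ) : Prop := IsPal q (N / 2) (numer q N φ)

theorem coeff_zero_one_sub_mul {R : Type*} [CommRing R] (q : R) (φ : PowerSeries R) :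
    PowerSeries.coeff 0 ((1 - PowerSeries.C q * PowerSeries.X) * φ) = PowerSeries.coeff 0 φ := by
  rw [sub_mul, one_mul, map_sub, mul_assoc, PowerSeries.coeff_C_mul,
    PowerSeries.coeff_zero_X_mul, mul_zero, sub_zero]

theorem coeff_succ_one_sub_mul {R : Type*} [CommRing R] (q : R) (φ : PowerSeries R) (k : ℕ) :
    PowerSeries.coeff (k + 1) ((1 - PowerSeries.C q * PowerSeries.X) * φ) =
      PowerSeries.coeff (k + 1) φ - q * PowerSeries.coeff k φ := by
  rw [sub_mul, one_mul, map_sub, mul_assoc, PowerSeries.coeff_C_mul,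
    PowerSeries.coeff_succ_X_mul]

theorem numer_mul {R : Type*} [CommRing R] (q : R) (N : ℕ) (φ φ' : PowerSeries R) :
    numer q N (φ * φ') = φ * numer q N φ' := by
  rw [numer, numer]
  split_ifs <;> ring

theorem numer_add {R : Type*} [CommRing R] (q : R) (N : ℕ) (φ χ : PowerSeries R) :
    numer q N (φ + χ) = numer q N φ + numer q N χ := by
  rw [numer, numer, numer]
  split_ifs <;> ring

theorem numer_sum {ι : Type*} (q : ℂ) (N : ℕ) (s : Finset ι) (φ : ι → PowerSeries ℂ) :
    numer q N (∑ i ∈ s, φ i) = ∑ i ∈ s, numer q N (φ i) := by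
  rw [numer]
  split_ifs with h
  · simp only [numer, if_pos h]
  · simp only [numer, if_neg h, Finset.mul_sum]

/-- A self-reciprocal factor raises the conductor degree by the even number `2 m`, so the parity
that decides the denominator is unchanged. -/
theorem IsPal.hasFE_mul {q : ℂ} (hq : q ≠ 0) {m N N' : ℕ} {φ φ' : PowerSeries ℂ} (h : IsPal q m φ)
    (h' : HasFE q N φ') (hN : N' = N + 2 * m) : HasFE q N' (φ * φ') := by
  subst hN
  have h1 : numer q (N + 2 * m) φ' = numer q N φ' := by
    simp [numer, Nat.add_mul_mod_self_left]
  have h2 : (N + 2 * m) / 2 = m + N / 2 := by omega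
  rw [HasFE, numer_mul, h1, h2]
  exact h.mul hq h'

theorem HasFE.C_mul {q : ℂ} {N : ℕ} {φ : PowerSeries ℂ} (h : HasFE q N φ) (c : ℂ) :
    HasFE q N (PowerSeries.C c * φ) := by
  rw [HasFE, numer_mul]
  exact IsPal.C_mul h c

/-! ### The functional equation of quadratic `L`-series -/

theorem residueSymbol_zero_left {F : Type} [Field F] {D : F[X]} (hD : D.Monic) (h1 : D ≠ 1) : residueSymbol 0 D = 0 := by
  obtain ⟨p, hp, hpi, hd⟩ := exists_monic_irreducible_factor D
    (fun h => h1 (hD.isUnit_iff.1 h))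
  exact residueSymbol_eq_zero ⟨hp, hpi⟩ hD.ne_zero (dvd_zero p) hd

section

variable {F : Type} [Field F] [Finite F]

theorem sum_polysLT_C_mul (k : ℕ) {c : F} (hc : c ≠ 0) (φ : F[X] → ℂ) :
    ∑ l ∈ polysLT F k, φ (C c * l) = ∑ l ∈ polysLT F k, φ l := by
  refine Finset.sum_nbij' (fun l => C c * l) (fun l => C c⁻¹ * l) ?_ ?_ ?_ ?_ ?_
  · intro l hl
    rwa [mem_polysLT, degree_C_mul hc, ← mem_polysLT]
  · intro l hl
    rwa [mem_polysLT, degree_C_mul (inv_ne_zero hc), ← mem_polysLT]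
  · intro l _
    rw [← mul_assoc, ← C_mul, inv_mul_cancel₀ hc, C_1, one_mul]
  · intro l _
    rw [← mul_assoc, ← C_mul, mul_inv_cancel₀ hc, C_1, one_mul]
  · intros; rfl

end

section

variable {F : Type} [Field F] [Fintype F]

open Classical in
-- A polynomial of exact degree `k` is a nonzero constant times a monic one.
theorem sum_polysLT_succ (k : ℕ) (φ : F[X] → ℂ) :
    ∑ r ∈ polysLT F (k + 1), φ r =
      ∑ r ∈ polysLT F k, φ r + ∑ c ∈ Finset.univ.erase (0 : F), ∑ m ∈ monics F k, φ (C c * m) := by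
  rw [sum_polysLT_add (monic_X_pow k) (natDegree_X_pow k), sum_polysLT_one,
    ← Finset.add_sum_erase _ _ (Finset.mem_univ (0 : F))]
  congr 1
  · simp
  · refine Finset.sum_congr rfl fun c hc => ?_
    rw [sum_monics, ← sum_polysLT_C_mul k (Finset.ne_of_mem_erase hc)]
    refine Finset.sum_congr rfl fun l _ => ?_
    congr 1
    ring

/-- The `L`-series of the character `m ↦ (m / D)`. -/
def quadLSeries (D : F[X]) : PowerSeries ℂ :=
  PowerSeries.mk fun k => ∑ m ∈ monics F k, (residueSymbol m D : ℂ)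

theorem card_monics (k : ℕ) : (monics F k).card = Nat.card F ^ k := by
  have h := sum_monics (F := F) k (fun _ => 1)
  simp only [Finset.sum_const, nsmul_eq_mul, mul_one, card_polysLT] at h
  exact_mod_cast h

open Classical in
-- Expand `(m / D)` as a Gauss sum and exchange the summations. Over `m = X ^ k + l` with `deg l <
-- k`, orthogonality keeps only the `r` with `deg r < deg D - k`.
theorem sum_monics_residueSymbol_mul {ψ : AddChar F ℂ} (hF : Nat.card F % 4 = 1) (hψ : ψ ≠ 1)
    {D : F[X]} (hD : D.Monic) (hsq : Squarefree D) (k : ℕ) :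
    (∑ m ∈ monics F k, (residueSymbol m D : ℂ)) * (∑ c : F, ψ (c ^ 2)) ^ D.natDegree =
      (Nat.card F : ℂ) ^ k * ∑ r ∈ polysLT F (D.natDegree - k),
        (residueSymbol r D : ℂ) * ψ (resCoeff D (X ^ k * r)) := by
  rw [Finset.sum_mul]
  simp only [← sum_residueSymbol_mul_addChar hF hψ hD hsq]
  rw [Finset.sum_comm]
  have h1 : ∀ r ∈ polysLT F D.natDegree,
      ∑ m ∈ monics F k, (residueSymbol r D : ℂ) * ψ (resCoeff D (m * r)) =
      if r ∈ polysLT F (D.natDegree - k) then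
        (Nat.card F : ℂ) ^ k * ((residueSymbol r D : ℂ) * ψ (resCoeff D (X ^ k * r))) else 0 := by
    intro r hr
    have h2 := sum_addChar_resCoeff_mul ψ hψ hD (mem_polysLT.1 hr) k
    have h3 : (r = 0 ∨ r.natDegree + k < D.natDegree) ↔ r ∈ polysLT F (D.natDegree - k) := by
      rw [mem_polysLT]
      rcases eq_or_ne r 0 with rfl | h0
      · simp
      · rw [degree_eq_natDegree h0, Nat.cast_lt]
        simp only [h0, false_or]
        omega
    rw [← Finset.mul_sum, sum_monics]
    simp only [add_mul, resCoeff_add, AddChar.map_add_eq_mul]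
    rw [← Finset.mul_sum]
    simp only [mul_comm _ r]
    rw [h2]
    simp only [h3]
    split_ifs <;> ring
  rw [Finset.sum_congr rfl h1, ← Finset.sum_filter, Finset.mul_sum]
  refine Finset.sum_congr ?_ fun _ _ => rfl
  ext r
  simp only [Finset.mem_filter, mem_polysLT, and_iff_right_iff_imp]
  exact fun h => h.trans_le (by exact_mod_cast Nat.sub_le _ _)

theorem sum_monics_residueSymbol_eq_zero (hF : Nat.card F % 4 = 1) {D : F[X]} (hD : D.Monic)
    (hsq : Squarefree D) (h1 : D ≠ 1) {k : ℕ} (hk : D.natDegree ≤ k) :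
    ∑ m ∈ monics F k, (residueSymbol m D : ℂ) = 0 := by
  obtain ⟨ψ, hψ⟩ := exists_addChar_ne_one F
  have h := sum_monics_residueSymbol_mul hF hψ hD hsq k
  rw [Nat.sub_eq_zero_of_le hk, polysLT_zero, Finset.sum_singleton,
    residueSymbol_zero_left hD h1] at h
  simp only [Int.cast_zero, zero_mul, mul_zero] at h
  exact (mul_eq_zero.1 h).resolve_right (pow_ne_zero _ (sum_addChar_sq_ne_zero hF hψ))

open Classical in
-- For `deg r ≤ j` the residue of `X ^ k r / D` is the coefficient of `t ^ j` in `r`. It vanishes in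
-- degree below `j`, and equals `c` at `r = c m` with `m` monic of degree `j`.
theorem sum_monics_residueSymbol_reflect {ψ : AddChar F ℂ} (hF : Nat.card F % 4 = 1) (hψ : ψ ≠ 1)
    {D : F[X]} (hD : D.Monic) (hsq : Squarefree D) {k j : ℕ} (hkj : k + j + 1 = D.natDegree) :
    (∑ m ∈ monics F k, (residueSymbol m D : ℂ)) * (∑ c : F, ψ (c ^ 2)) ^ D.natDegree =
      (Nat.card F : ℂ) ^ k * (∑ r ∈ polysLT F j, (residueSymbol r D : ℂ) +
        (∑ c ∈ Finset.univ.erase (0 : F), (quadraticChar F c : ℂ) ^ D.natDegree * ψ c) *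
          ∑ m ∈ monics F j, (residueSymbol m D : ℂ)) := by
  rw [sum_monics_residueSymbol_mul hF hψ hD hsq]
  have h1 : D.natDegree - k = j + 1 := by omega
  rw [h1, sum_polysLT_succ]
  have h2 : ∀ r : F[X], r.degree < (j + 1 : ℕ) → resCoeff D (X ^ k * r) = r.coeff j := by
    intro r hr
    rw [resCoeff_of_degree_lt hD]
    · have : D.natDegree - 1 = j + k := by omega
      rw [this, mul_comm, coeff_mul_X_pow]
    · rw [degree_eq_natDegree hD.ne_zero, ← hkj, add_assoc]
      exact degree_mul_lt_add (degree_X_pow k) hr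
  congr 2
  · refine Finset.sum_congr rfl fun r hr => ?_
    rw [mem_polysLT] at hr
    rw [h2 r (hr.trans (by exact_mod_cast Nat.lt_succ_self j)), coeff_eq_zero_of_degree_lt hr,
      AddChar.map_zero_eq_one, mul_one]
  · rw [Finset.sum_mul_sum]
    refine Finset.sum_congr rfl fun c hc => Finset.sum_congr rfl fun m hm => ?_
    have hc := Finset.ne_of_mem_erase hc
    rw [mem_monics] at hm
    rw [h2, coeff_C_mul, ← hm.2, hm.1.coeff_natDegree, mul_one, residueSymbol_mul_left,
      residueSymbol_C hF hD hsq hc]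
    · push_cast
      ring
    · rw [degree_C_mul hc, degree_eq_natDegree hm.1.ne_zero, hm.2]
      exact_mod_cast Nat.lt_succ_self j

open Classical in
theorem sum_polysLT_residueSymbol_succ (hF : Nat.card F % 4 = 1) {D : F[X]} (hD : D.Monic)
    (hsq : Squarefree D) (j : ℕ) :
    ∑ r ∈ polysLT F (j + 1), (residueSymbol r D : ℂ) =
      ∑ r ∈ polysLT F j, (residueSymbol r D : ℂ) +
        (∑ c ∈ Finset.univ.erase (0 : F), (quadraticChar F c : ℂ) ^ D.natDegree) *
          ∑ m ∈ monics F j, (residueSymbol m D : ℂ) := by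
  rw [sum_polysLT_succ, Finset.sum_mul_sum]
  congr 1
  refine Finset.sum_congr rfl fun c hc => Finset.sum_congr rfl fun m _ => ?_
  rw [residueSymbol_mul_left, residueSymbol_C hF hD hsq (Finset.ne_of_mem_erase hc)]
  push_cast
  ring

/-- The character is nontrivial on constants, so its sums over all polynomials of bounded degree
vanish. The remaining factor in the reflection formula is the Gauss sum `τ`, which cancels against
one factor of `τ ^ (2 m + 1)`. -/
theorem hasFE_quadLSeries_of_odd (hF : Nat.card F % 4 = 1) {D : F[X]} (hD : D.Monic)
    (hsq : Squarefree D) (hodd : D.natDegree % 2 = 1) :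
    HasFE (Nat.card F) D.natDegree (quadLSeries D) := by
  classical
  have h1 : D ≠ 1 := by rintro rfl; simp at hodd
  obtain ⟨ψ, hψ⟩ := exists_addChar_ne_one F
  have hr := ringChar_ne_two_of_card hF
  obtain ⟨m, hm⟩ : ∃ m, D.natDegree = 2 * m + 1 := ⟨D.natDegree / 2, by omega⟩
  have hpow : ∀ c : F, (quadraticChar F c : ℂ) ^ D.natDegree = quadraticChar F c := by
    intro c
    by_cases hc : c = 0
    · simp [hc, hm]
    · have : (quadraticChar F c : ℂ) ^ 2 = 1 := by exact_mod_cast quadraticChar_sq_one hc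
      rw [hm, pow_succ, pow_mul, this, one_pow, one_mul]
  have hT : ∀ j, ∑ r ∈ polysLT F j, (residueSymbol r D : ℂ) = 0 := by
    intro j
    induction j with
    | zero => rw [polysLT_zero, Finset.sum_singleton, residueSymbol_zero_left hD h1, Int.cast_zero]
    | succ j ih =>
      rw [sum_polysLT_residueSymbol_succ hF hD hsq, ih]
      simp only [hpow]
      rw [Finset.sum_erase _ (by simp), ← Int.cast_sum, quadraticChar_sum_zero hr]
      simp
  have hG : ∑ c ∈ Finset.univ.erase (0 : F), (quadraticChar F c : ℂ) ^ D.natDegree * ψ c =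
      ∑ c : F, ψ (c ^ 2) := by
    simp only [hpow]
    rw [Finset.sum_erase _ (by simp),
      sum_addChar_sq hr ψ (AddChar.sum_eq_zero_of_ne_one hψ)]
  have hτ0 := sum_addChar_sq_ne_zero hF hψ
  have hτ := sum_addChar_sq_sq hF hψ
  have hN : D.natDegree / 2 = m := by omega
  rw [HasFE, numer, if_pos hodd, hN]
  refine ⟨fun k l hkl => ?_, fun k hk => ?_⟩
  · simp only [quadLSeries, PowerSeries.coeff_mk]
    have h := sum_monics_residueSymbol_reflect hF hψ hD hsq (k := k) (j := l) (by omega)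
    rw [hT, hG, zero_add, hm, pow_succ, pow_mul, hτ] at h
    refine mul_right_cancel₀ hτ0 ?_
    linear_combination -h
  · rw [quadLSeries, PowerSeries.coeff_mk]
    exact sum_monics_residueSymbol_eq_zero hF hD hsq h1 (by omega)

theorem hasFE_quadLSeries_one : HasFE (Nat.card F) 0 (quadLSeries (1 : F[X])) := by
  have h : numer (Nat.card F : ℂ) 0 (quadLSeries (1 : F[X])) = 1 := by
    rw [numer, if_neg (by norm_num)]
    ext k
    cases k with
    | zero => simp [quadLSeries, card_monics]
    | succ k =>
      rw [coeff_succ_one_sub_mul]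
      simp [quadLSeries, card_monics, pow_succ, mul_comm, PowerSeries.coeff_one]
  rw [HasFE, h]
  refine ⟨fun k l hkl => ?_, fun k hk => ?_⟩
  · obtain ⟨rfl, rfl⟩ : k = 0 ∧ l = 0 := by omega
    simp
  · rw [PowerSeries.coeff_one, if_neg (by omega)]

/-- The character is trivial on constants. The reflection formula then contains the sums `T j` over
all polynomials of degree below `j`, but they cancel in the combination `A (k + 1) - q * A k`, the
coefficient of `(1 - q x) L`. The case `D = 1` is excluded because its `L`-series is not a
polynomial. -/
theorem hasFE_quadLSeries_of_even (hF : Nat.card F % 4 = 1) {D : F[X]} (hD : D.Monic)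
    (hsq : Squarefree D) (h1 : D ≠ 1) (heven : D.natDegree % 2 = 0) :
    HasFE (Nat.card F) D.natDegree (quadLSeries D) := by
  classical
  obtain ⟨ψ, hψ⟩ := exists_addChar_ne_one F
  obtain ⟨m, hm⟩ : ∃ m, D.natDegree = 2 * m := ⟨D.natDegree / 2, by omega⟩
  have hm0 : m ≠ 0 := by
    rintro rfl
    exact h1 (hD.natDegree_eq_zero.1 hm)
  have hpow : ∀ c ∈ Finset.univ.erase (0 : F),
      (quadraticChar F c : ℂ) ^ D.natDegree = 1 := by
    intro c hc
    have : (quadraticChar F c : ℂ) ^ 2 = 1 := by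
      exact_mod_cast quadraticChar_sq_one (Finset.ne_of_mem_erase hc)
    rw [hm, pow_mul, this, one_pow]
  have hsum1 : ∑ c ∈ Finset.univ.erase (0 : F), (quadraticChar F c : ℂ) ^ D.natDegree =
      Nat.card F - 1 := by
    rw [Finset.sum_congr rfl hpow, Finset.sum_const, Finset.card_erase_of_mem (Finset.mem_univ _),
      Finset.card_univ, nsmul_eq_mul, mul_one, Nat.card_eq_fintype_card,
      Nat.cast_sub Fintype.card_pos, Nat.cast_one]
  have hsum2 : ∑ c ∈ Finset.univ.erase (0 : F), (quadraticChar F c : ℂ) ^ D.natDegree * ψ c =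
      -1 := by
    have h2 : ∀ c ∈ Finset.univ.erase (0 : F),
        (quadraticChar F c : ℂ) ^ D.natDegree * ψ c = ψ c := by
      intro c hc
      rw [hpow c hc, one_mul]
    have h3 := Finset.add_sum_erase Finset.univ ψ (Finset.mem_univ (0 : F))
    rw [AddChar.sum_eq_zero_of_ne_one hψ, AddChar.map_zero_eq_one] at h3
    rw [Finset.sum_congr rfl h2]
    linear_combination h3
  have hτ := sum_addChar_sq_sq hF hψ
  set q : ℂ := (Nat.card F : ℂ) with hq
  have hq0 : q ≠ 0 := Nat.cast_ne_zero.2 Nat.card_pos.ne'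
  set A : ℕ → ℂ := fun k => ∑ m ∈ monics F k, (residueSymbol m D : ℂ) with hA
  set T : ℕ → ℂ := fun k => ∑ r ∈ polysLT F k, (residueSymbol r D : ℂ) with hTdef
  have hT0 : T 0 = 0 := by
    simp only [hTdef]
    rw [polysLT_zero, Finset.sum_singleton, residueSymbol_zero_left hD h1, Int.cast_zero]
  have hTs : ∀ j, T (j + 1) = T j + (q - 1) * A j := by
    intro j
    rw [← hsum1]
    exact sum_polysLT_residueSymbol_succ hF hD hsq j
  have hrefl : ∀ k j, k + j + 1 = 2 * m → A k * q ^ m = q ^ k * (T j - A j) := by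
    intro k j hkj
    have h := sum_monics_residueSymbol_reflect hF hψ hD hsq (k := k) (j := j) (by omega)
    rw [hsum2, hm, pow_mul, hτ] at h
    simp only [hA, hTdef]
    rw [h]
    ring
  have hA0 : ∀ k, 2 * m ≤ k → A k = 0 := fun k hk =>
    sum_monics_residueSymbol_eq_zero hF hD hsq h1 (by omega)
  have hN : D.natDegree / 2 = m := by omega
  rw [HasFE, numer, if_neg (by omega), hN]
  have hlast : ∀ l, l + 1 = 2 * m → A l * q ^ m = - (q ^ l * A 0) := by
    intro l hl
    rw [hrefl l 0 (by omega), hT0]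
    ring
  have hqq : ∀ l, l + 1 = 2 * m → q ^ l * q = q ^ m * q ^ m := by
    intro l hl
    rw [← pow_succ, hl, two_mul, pow_add]
  have hqm : q ^ m ≠ 0 := pow_ne_zero m hq0
  refine ⟨fun k l hkl => ?_, fun k hk => ?_⟩
  · rcases k with _ | k <;> rcases l with _ | l
    · omega
    · rw [coeff_succ_one_sub_mul, coeff_zero_one_sub_mul]
      simp only [quadLSeries, PowerSeries.coeff_mk]
      change q ^ 0 * (A (l + 1) - q * A l) = q ^ m * A 0
      rw [hA0 (l + 1) (by omega)]
      refine mul_right_cancel₀ hqm ?_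
      linear_combination -q * hlast l (by omega) + A 0 * hqq l (by omega)
    · rw [coeff_succ_one_sub_mul, coeff_zero_one_sub_mul]
      simp only [quadLSeries, PowerSeries.coeff_mk]
      change q ^ (k + 1) * A 0 = q ^ m * (A (k + 1) - q * A k)
      rw [hA0 (k + 1) (by omega), pow_succ]
      linear_combination q * hlast k (by omega)
    · rw [coeff_succ_one_sub_mul, coeff_succ_one_sub_mul]
      simp only [quadLSeries, PowerSeries.coeff_mk]
      change q ^ (k + 1) * (A (l + 1) - q * A l) = q ^ m * (A (k + 1) - q * A k)
      -- Both reflections are expressed through the same `T l`, which cancels from `-e1 + q * e2`.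
      have e1 := hrefl (k + 1) l (by omega)
      have e2 := hrefl k (l + 1) (by omega)
      rw [hTs] at e2
      rw [pow_succ] at e1 ⊢
      linear_combination -e1 + q * e2
  · obtain ⟨k, rfl⟩ : ∃ j, k = j + 1 := ⟨k - 1, by omega⟩
    rw [coeff_succ_one_sub_mul]
    simp only [quadLSeries, PowerSeries.coeff_mk]
    change A (k + 1) - q * A k = 0
    rw [hA0 k (by omega), hA0 (k + 1) (by omega)]
    ring

theorem hasFE_quadLSeries (hF : Nat.card F % 4 = 1) {D : F[X]} (hD : D.Monic)
    (hsq : Squarefree D) : HasFE (Nat.card F) D.natDegree (quadLSeries D) := by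
  rcases Nat.mod_two_eq_zero_or_one D.natDegree with h | h
  · rcases eq_or_ne D 1 with rfl | h1
    · rw [natDegree_one]
      exact hasFE_quadLSeries_one
    · exact hasFE_quadLSeries_of_even hF hD hsq h1 h
  · exact hasFE_quadLSeries_of_odd hF hD hsq h

end


/-! ### Splitting off an Euler factor -/

theorem IsPal.expand {q : ℂ} (hq : q ≠ 0) {m d : ℕ} (hd : d ≠ 0) {φ : PowerSeries ℂ} {ε : ℂ}
    (hε : ε ^ 2 = 1) (h : IsPal (q ^ d) m φ) :
    IsPal q (m * d) (PowerSeries.expand d hd (PowerSeries.rescale ε φ)) := by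
  have h0 : q ^ d ≠ 0 := pow_ne_zero d hq
  obtain ⟨P, rfl, -⟩ := h.exists_polynomial
  have key : PowerSeries.expand d hd (PowerSeries.rescale ε (P : PowerSeries ℂ)) =
      ((P.comp (C ε * X ^ d) : ℂ[X]) : PowerSeries ℂ) := by
    have hhom : ((PowerSeries.expand d hd : PowerSeries ℂ →ₐ[ℂ] PowerSeries ℂ) :
        PowerSeries ℂ →+* PowerSeries ℂ).comp
          ((PowerSeries.rescale ε).comp Polynomial.coeToPowerSeries.ringHom) =
        Polynomial.coeToPowerSeries.ringHom.comp (compRingHom (C ε * X ^ d)) := by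
      refine Polynomial.ringHom_ext (fun a => ?_) ?_
      · have : PowerSeries.rescale ε (PowerSeries.C a) = PowerSeries.C a := by
          ext k
          rw [PowerSeries.coeff_rescale, PowerSeries.coeff_C]
          split_ifs with hk <;> simp [hk]
        simp [this, PowerSeries.expand_C]
      · simp [PowerSeries.rescale_X, PowerSeries.expand_C]
    exact DFunLike.congr_fun hhom P
  rw [key]
  exact h.comp hq hε

section

variable {F : Type} [Field F]

theorem finiteMultiplicity {p f : F[X]} (hp : IsPrimePoly p) (hf : f ≠ 0) :
    FiniteMultiplicity p f :=
  FiniteMultiplicity.of_not_isUnit hp.2.not_isUnit hf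

theorem multiplicity_pow_mul {p m : F[X]} (hp : IsPrimePoly p) (k : ℕ) (hm : ¬ p ∣ m) :
    multiplicity p (p ^ k * m) = k := by
  refine multiplicity_eq_of_dvd_of_not_dvd (dvd_mul_right _ _) ?_
  rw [pow_succ, mul_dvd_mul_iff_left (pow_ne_zero k hp.1.ne_zero)]
  exact hm

theorem exists_eq_pow_multiplicity_mul {p f : F[X]} (hp : IsPrimePoly p) (hf : f.Monic) :
    ∃ g : F[X], g.Monic ∧ ¬ p ∣ g ∧ f = p ^ multiplicity p f * g := by
  obtain ⟨g, hg, hpg⟩ := (finiteMultiplicity hp hf.ne_zero).exists_eq_pow_mul_and_not_dvd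
  have hpk := hp.1.pow (multiplicity p f)
  exact ⟨g, hpk.of_mul_monic_left (hg ▸ hf), hpg, hg⟩

theorem not_dvd_of_isCoprime {p E f : F[X]} (hp : IsPrimePoly p) (h : IsCoprime E f) (hf : p ∣ f) :
    ¬ p ∣ E := fun hE => hp.2.not_isUnit (h.isUnit_of_dvd' hE hf)

open Classical in
-- Every monic `f` is uniquely `p ^ k m` with `p` not dividing `m`, so a weight that factors
-- accordingly yields an Euler factor at `p` times a series over the `m` prime to `p`.
theorem mk_sum_monics_eq_mul [Finite F] {p : F[X]} (hp : IsPrimePoly p) (hd : p.natDegree ≠ 0)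
    (G b : F[X] → ℂ) (a : ℕ → ℂ)
    (h : ∀ k m, m.Monic → ¬ p ∣ m → G (p ^ k * m) = a k * b m) :
    (PowerSeries.mk fun N => ∑ f ∈ monics F N, G f) =
      PowerSeries.expand p.natDegree hd (PowerSeries.mk a) *
        PowerSeries.mk fun N => ∑ m ∈ monics F N with ¬ p ∣ m, b m := by
  ext N
  rw [PowerSeries.coeff_mk, PowerSeries.coeff_mul]
  have hmap : ∀ f ∈ monics F N,
      (p.natDegree * multiplicity p f, N - p.natDegree * multiplicity p f) ∈
        Finset.HasAntidiagonal.antidiagonal N := by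
    intro f hf
    rw [mem_monics] at hf
    obtain ⟨g, hg, -, hfg⟩ := exists_eq_pow_multiplicity_mul hp hf.1
    have := congrArg natDegree hfg
    rw [(hp.1.pow _).natDegree_mul hg, hp.1.natDegree_pow, hf.2] at this
    rw [Finset.HasAntidiagonal.mem_antidiagonal, mul_comm]
    dsimp only
    omega
  rw [← Finset.sum_fiberwise_of_maps_to hmap]
  refine Finset.sum_congr rfl ?_
  rintro ⟨i, j⟩ hij
  rw [Finset.HasAntidiagonal.mem_antidiagonal] at hij
  dsimp only at hij ⊢
  by_cases hi : p.natDegree ∣ i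
  · obtain ⟨k, rfl⟩ := hi
    rw [PowerSeries.coeff_expand_mul, PowerSeries.coeff_mk, PowerSeries.coeff_mk, Finset.mul_sum]
    symm
    refine Finset.sum_nbij (fun m => p ^ k * m) ?_ ?_ ?_ ?_
    · intro m hm
      rw [Finset.mem_filter, mem_monics] at hm
      rw [Finset.mem_filter, mem_monics, multiplicity_pow_mul hp k hm.2,
        (hp.1.pow _).natDegree_mul hm.1.1, hp.1.natDegree_pow, hm.1.2, mul_comm k]
      refine ⟨⟨(hp.1.pow _).mul hm.1.1, hij⟩, ?_⟩
      rw [Prod.mk.injEq]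
      omega
    · intro m _ m' _ e
      exact mul_left_cancel₀ (pow_ne_zero k hp.1.ne_zero) e
    · intro f hf
      simp only [Finset.coe_filter, mem_monics, Set.mem_ofPred_eq, Prod.mk.injEq] at hf
      obtain ⟨g, hg, hpg, hfg⟩ := exists_eq_pow_multiplicity_mul hp hf.1.1
      have hk : multiplicity p f = k := Nat.eq_of_mul_eq_mul_left (Nat.pos_of_ne_zero hd) hf.2.1
      rw [hk] at hfg
      refine ⟨g, ?_, hfg.symm⟩
      simp only [Finset.coe_filter, mem_monics, Set.mem_ofPred_eq]
      refine ⟨⟨hg, ?_⟩, hpg⟩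
      have := congrArg natDegree hfg
      rw [(hp.1.pow _).natDegree_mul hg, hp.1.natDegree_pow, hf.1.2, mul_comm] at this
      omega
    · intro m hm
      rw [Finset.mem_filter, mem_monics] at hm
      exact (h k m hm.1.1 hm.2).symm
  · rw [PowerSeries.coeff_expand_of_not_dvd _ _ _ hi, zero_mul]
    refine Finset.sum_eq_zero fun f hf => absurd ?_ hi
    rw [Finset.mem_filter, Prod.mk.injEq] at hf
    exact ⟨_, hf.2.1.symm⟩

end

/-! ### The inner sums over `f_i` -/

section

variable {n : ℕ} {H : LocalWeights n} {c h : (ZMod (n + 1) → ℕ) → ℂ[X]}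
  {F : Type} [Field F] [Finite F]

/-- The series `∑ H(u_0, …, m, …, u_n) (m / E) x ^ deg m` (`m` in position `i`). -/
def twistedSeries (H : LocalWeights n) (i : ZMod (n + 1)) (u : ZMod (n + 1) → F[X]) (E : F[X]) :
    PowerSeries ℂ :=
  PowerSeries.mk fun k =>
    ∑ m ∈ monics F k, H F (Function.update u i m) * (residueSymbol m E : ℂ)

/-- The series `∑ h_{b_0, …, k, …, b_n}(Q) y ^ k` (`k` in position `i`). -/
def localCoeffSeries (h : (ZMod (n + 1) → ℕ) → ℂ[X]) (i : ZMod (n + 1)) (b : ZMod (n + 1) → ℕ)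
    (Q : ℂ) : PowerSeries ℂ :=
  PowerSeries.mk fun k => (h (Function.update b i k)).eval Q

/-- The functional equation of the local series at primes of norm `Q`. -/
def HasLocalFE (h : (ZMod (n + 1) → ℕ) → ℂ[X]) (i : ZMod (n + 1)) (b : ZMod (n + 1) → ℕ)
    (Q : ℂ) : Prop :=
  IsPal Q ((b (i - 1) + b (i + 1)) / 2)
    (numer (1 : ℂ) (b (i - 1) + b (i + 1)) (localCoeffSeries h i b Q))

theorem add_one_ne_self (hn : 2 ≤ n) (i : ZMod (n + 1)) : i + 1 ≠ i := by
  have : Fact (1 < n + 1) := ⟨by omega⟩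
  simp

theorem sub_one_ne_self (hn : 2 ≤ n) (i : ZMod (n + 1)) : i - 1 ≠ i := by
  have : Fact (1 < n + 1) := ⟨by omega⟩
  simp

theorem sub_one_ne_add_one (hn : 2 ≤ n) (i : ZMod (n + 1)) : i - 1 ≠ i + 1 := by
  intro h
  have h2 : ((2 : ℕ) : ZMod (n + 1)) = 0 := by
    push_cast
    linear_combination -h
  rw [ZMod.natCast_eq_zero_iff] at h2
  have := Nat.le_of_dvd (by norm_num) h2
  omega

/-- In the twisting product only the factors at `j = i` and `j = i - 1` involve `p ^ k` or `m`; the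
others form `C`. By reciprocity these two give `(p / g_{i-1} g_{i+1}) ^ k` and `(m / p) ^ (b_{i-1} +
b_{i+1})`. The twist by `E` supplies the remaining symbols. -/
theorem exists_twisted_factorization (hn : 2 ≤ n) (hH : SatisfiesAxioms H c h)
    (hF : Nat.card F % 4 = 1) (i : ZMod (n + 1)) {p : F[X]} (hp : IsPrimePoly p)
    {g : ZMod (n + 1) → F[X]} (hg : ∀ j, (g j).Monic) (hpg : ∀ j, ¬ p ∣ g j) {E : F[X]}
    {b : ZMod (n + 1) → ℕ} (hE : E.Monic) :
    ∃ C : ℂ, (b = 0 ∨ g = 1 → C = 1) ∧ ∀ (k : ℕ) (m : F[X]), m.Monic → ¬ p ∣ m →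
      H F (Function.update (fun j => p ^ b j * g j) i (p ^ k * m)) *
          (residueSymbol (p ^ k * m) E : ℂ) =
        (C * (residueSymbol p (E * (g (i - 1) * g (i + 1))) : ℂ) ^ k *
          (h (Function.update b i k)).eval ((Nat.card F : ℂ) ^ p.natDegree)) *
        (H F (Function.update g i m) *
          ((residueSymbol m E : ℂ) * (residueSymbol m p : ℂ) ^ (b (i - 1) + b (i + 1)))) := by
  classical
  have hi1 := add_one_ne_self hn i
  have hi2 := sub_one_ne_self hn i
  refine ⟨∏ j ∈ (Finset.univ.erase i).erase (i - 1),
    ((residueSymbol (p ^ b j) (g (j + 1)) : ℂ) * (residueSymbol (g j) (p ^ b (j + 1)) : ℂ)), ?_, ?_⟩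
  · rintro (rfl | rfl) <;> simp
  intro k m hm hpm
  have h1 : Function.update (fun j => p ^ b j * g j) i (p ^ k * m) =
      fun j => p ^ Function.update b i k j * Function.update g i m j := by
    funext j
    rcases eq_or_ne j i with rfl | hj
    · simp
    · simp [hj]
  have hg' : ∀ j, (Function.update g i m j).Monic := by
    intro j
    rcases eq_or_ne j i with rfl | hj
    · simpa
    · simpa [hj] using hg j
  have hpg' : ∀ j, ¬ p ∣ Function.update g i m j := by
    intro j
    rcases eq_or_ne j i with rfl | hj
    · simpa
    · simpa [hj] using hpg j
  have hcop : IsCoprime (∏ j, p ^ Function.update b i k j) (∏ j, Function.update g i m j) :=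
    IsCoprime.prod_left fun j _ => IsCoprime.prod_right fun l _ =>
      (hp.isCoprime (hpg' l)).pow_left
  rw [h1, hH.twisted_mul F hF _ _ (fun j => hp.1.pow _) hg' hcop, hH.local_eq F hF p hp]
  rw [← Finset.mul_prod_erase _ _ (Finset.mem_univ i),
    ← Finset.mul_prod_erase _ _ (Finset.mem_erase.2 ⟨hi2, Finset.mem_univ (i - 1)⟩)]
  have h2 : ∀ j ∈ (Finset.univ.erase i).erase (i - 1),
      ((residueSymbol (p ^ Function.update b i k j) (Function.update g i m (j + 1)) : ℂ) *
        (residueSymbol (Function.update g i m j) (p ^ Function.update b i k (j + 1)) : ℂ)) =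
      ((residueSymbol (p ^ b j) (g (j + 1)) : ℂ) *
        (residueSymbol (g j) (p ^ b (j + 1)) : ℂ)) := by
    intro j hj
    rw [Finset.mem_erase, Finset.mem_erase] at hj
    have hj1 : j + 1 ≠ i := fun e => hj.1 (eq_sub_of_add_eq e)
    simp [hj.2.1, hj1]
  rw [Finset.prod_congr rfl h2]
  simp only [Function.update_self, sub_add_cancel, Function.update_of_ne hi1,
    Function.update_of_ne hi2]
  simp only [residueSymbol_pow_left, residueSymbol_mul_left, residueSymbol_pow_right _ hp.1.ne_zero,
    residueSymbol_mul_right _ hE.ne_zero (mul_ne_zero (hg (i - 1)).ne_zero (hg (i + 1)).ne_zero),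
    residueSymbol_mul_right _ (hg (i - 1)).ne_zero (hg (i + 1)).ne_zero,
    residueSymbol_reciprocity hF hm hp.1, residueSymbol_reciprocity hF (hg (i - 1)) hp.1]
  push_cast
  ring

/-- Splitting off the factors `p ^ b j` of the polynomials `p ^ b j * g j`. -/
theorem exists_twistedSeries_pow_mul (hn : 2 ≤ n) (hH : SatisfiesAxioms H c h)
    (hF : Nat.card F % 4 = 1) (i : ZMod (n + 1)) {p : F[X]} (hp : IsPrimePoly p)
    (hd : p.natDegree ≠ 0) {g : ZMod (n + 1) → F[X]} (hg : ∀ j, (g j).Monic)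
    (hpg : ∀ j, ¬ p ∣ g j) {E : F[X]} (hE : E.Monic)
    (b : ZMod (n + 1) → ℕ) :
    ∃ K : ℂ, (g = 1 → K = 1) ∧ twistedSeries H i (fun j => p ^ b j * g j) E =
      PowerSeries.C K *
        (PowerSeries.expand p.natDegree hd (PowerSeries.rescale
          (residueSymbol p (E * (g (i - 1) * g (i + 1))) : ℂ)
          (numer (1 : ℂ) (b (i - 1) + b (i + 1))
            (localCoeffSeries h i b ((Nat.card F : ℂ) ^ p.natDegree)))) *
        twistedSeries H i g (E * p ^ ((b (i - 1) + b (i + 1)) % 2))) := by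
  set ε : ℂ := (residueSymbol p (E * (g (i - 1) * g (i + 1))) : ℂ) with hεdef
  obtain ⟨K, hK1, hK⟩ := exists_twisted_factorization (b := b) hn hH hF i hp hg hpg hE
  refine ⟨K, fun h => hK1 (Or.inr h), ?_⟩
  set s := b (i - 1) + b (i + 1) with hs
  classical
  set Dp : PowerSeries ℂ := PowerSeries.mk fun N => ∑ m ∈ monics F N with ¬ p ∣ m,
    (H F (Function.update g i m) *
      ((residueSymbol m E : ℂ) * (residueSymbol m p : ℂ) ^ s)) with hDp
  have hW : twistedSeries H i (fun j => p ^ b j * g j) E = PowerSeries.C K *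
      PowerSeries.expand p.natDegree hd (PowerSeries.rescale ε
        (localCoeffSeries h i b ((Nat.card F : ℂ) ^ p.natDegree))) * Dp := by
    rw [twistedSeries, mk_sum_monics_eq_mul hp hd _ _ _ hK, localCoeffSeries,
      PowerSeries.rescale_mk]
    congr 1
    rw [← PowerSeries.expand_C p.natDegree hd K, ← map_mul]
    congr 1
    ext k
    rw [PowerSeries.coeff_C_mul, PowerSeries.coeff_mk, PowerSeries.coeff_mk]
    ring
  rcases Nat.mod_two_eq_zero_or_one s with hs2 | hs2
  · -- the character is unramified at `p`
    -- Taking `b = 0` isolates the Euler factor at `p` of the series for `g`. All its weights are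
    -- `1`, so it is the geometric series in `ε x ^ deg p`.
    obtain ⟨K₀, hK₀, hK₀'⟩ :=
      exists_twisted_factorization (b := 0) hn hH hF i hp hg hpg hE
    have hg0 : (fun j => p ^ (0 : ZMod (n + 1) → ℕ) j * g j) = g := by
      funext j
      simp
    rw [hg0, hK₀ (Or.inl rfl), ← hεdef] at hK₀'
    have hone : ∀ k, (h (Function.update 0 i k)).eval ((Nat.card F : ℂ) ^ p.natDegree) = 1 := by
      intro k
      rw [← hH.local_eq F hF p hp, ← hH.initial_local F hF i (p ^ k) (hp.1.pow k)]
      congr 1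
      funext j
      rcases eq_or_ne j i with rfl | hj
      · simp
      · simp [hj]
    have hW' : twistedSeries H i g E =
        PowerSeries.expand p.natDegree hd (PowerSeries.rescale ε (PowerSeries.mk 1)) * Dp := by
      rw [twistedSeries, mk_sum_monics_eq_mul hp hd _ _ _ hK₀', PowerSeries.rescale_mk]
      congr 1
      · congr 2
        funext k
        rw [hone]
        simp
      · rw [hDp]
        congr 1
        funext N
        refine Finset.sum_congr rfl fun m hm => ?_
        rw [Finset.mem_filter] at hm
        have hmp : (residueSymbol m p : ℂ) ^ 2 = 1 := by
          exact_mod_cast residueSymbol_sq hp.1 (hp.isCoprime hm.2).symm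
        obtain ⟨t, ht⟩ : ∃ t, s = 2 * t := ⟨s / 2, by omega⟩
        rw [ht, pow_mul, hmp, one_pow]
        simp
    -- The series over `m` prime to `p` is the full series divided by this geometric series. The
    -- factor `1 - ε x ^ deg p` so produced is the one that completes the local series to its
    -- numerator.
    have hDp' : Dp = PowerSeries.expand p.natDegree hd (PowerSeries.rescale ε
        (1 - PowerSeries.C 1 * PowerSeries.X)) * twistedSeries H i g E := by
      rw [hW', ← mul_assoc, ← map_mul, ← map_mul]
      have : (1 - PowerSeries.C (1 : ℂ) * PowerSeries.X) * PowerSeries.mk 1 = 1 := by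
        rw [map_one, one_mul, mul_comm]
        exact PowerSeries.mk_one_mul_one_sub_eq_one ℂ
      rw [this, map_one, map_one, one_mul]
    rw [numer, if_neg (by omega), hs2, pow_zero, mul_one, map_mul, map_mul, hW, hDp']
    ring
  · -- the character is ramified at `p`
    -- An odd power of `(m / p)` is the symbol itself and kills the multiples of `p`, so the
    -- condition `p ∤ m` is absorbed into the conductor.
    have hW' : Dp = twistedSeries H i g (E * p) := by
      rw [hDp, twistedSeries]
      congr 1
      funext N
      rw [Finset.sum_filter]
      refine Finset.sum_congr rfl fun m _ => ?_
      rw [residueSymbol_mul_right _ hE.ne_zero hp.1.ne_zero]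
      by_cases hm : p ∣ m
      · rw [if_neg (not_not.2 hm), residueSymbol_eq_zero hp hp.1.ne_zero hm dvd_rfl]
        simp
      · rw [if_pos hm]
        have hmp : (residueSymbol m p : ℂ) ^ 2 = 1 := by
          exact_mod_cast residueSymbol_sq hp.1 (hp.isCoprime hm).symm
        obtain ⟨t, ht⟩ : ∃ t, s = 2 * t + 1 := ⟨s / 2, by omega⟩
        rw [ht, pow_succ, pow_mul, hmp, one_pow]
        push_cast
        ring
    rw [numer, if_pos hs2, hs2, pow_one, hW, hW', mul_assoc]

/-- The functional equation of the inner sum over `f_i`, given those of the local series. -/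
theorem hasFE_twistedSeries (hn : 2 ≤ n) (hH : SatisfiesAxioms H c h)
    (hF : Nat.card F % 4 = 1) (i : ZMod (n + 1)) (u : ZMod (n + 1) → F[X])
    (hu : ∀ j, (u j).Monic) (hui : u i = 1) (E : F[X]) (hE : E.Monic) (hsq : Squarefree E)
    (hcop : ∀ j, IsCoprime E (u j))
    (hloc : ∀ p, IsPrimePoly p → (∃ j, p ∣ u j) →
      HasLocalFE h i (fun j => multiplicity p (u j)) ((Nat.card F : ℂ) ^ p.natDegree)) :
    HasFE (Nat.card F) ((u (i - 1)).natDegree + (u (i + 1)).natDegree + E.natDegree)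
      (twistedSeries H i u E) := by
  have hq : (Nat.card F : ℂ) ≠ 0 := Nat.cast_ne_zero.2 Nat.card_pos.ne'
  -- Each step strips one prime `p` from all `u j` and moves `p` into `E` if its total exponent at
  -- `i ± 1` is odd. When every `u j` is `1`, the `L`-series of `E` is left.
  induction hN : ∑ j, (u j).natDegree using Nat.strong_induction_on generalizing u E with
  | _ N ih =>
    by_cases hall : ∀ j, u j = 1
    · have := Fintype.ofFinite F
      have h1 : twistedSeries H i u E = quadLSeries E := by
        rw [twistedSeries, quadLSeries]
        congr 1
        funext k
        refine Finset.sum_congr rfl fun m hm => ?_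
        rw [mem_monics] at hm
        have : Function.update u i m = Pi.mulSingle i m := by
          rw [Pi.mulSingle, show u = 1 from funext hall]
        rw [this, hH.initial_local F hF i m hm.1, one_mul]
      rw [h1, hall, hall, natDegree_one, zero_add, zero_add]
      exact hasFE_quadLSeries hF hE hsq
    · push Not at hall
      obtain ⟨j₀, hj₀⟩ := hall
      obtain ⟨p, hpm, hpi, hpd⟩ := exists_monic_irreducible_factor (u j₀)
        (fun h => hj₀ ((hu j₀).isUnit_iff.1 h))
      have hp : IsPrimePoly p := ⟨hpm, hpi⟩
      have hd : p.natDegree ≠ 0 := hpi.natDegree_pos.ne'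
      choose g hg hpg hug using fun j => exists_eq_pow_multiplicity_mul hp (hu j)
      set b : ZMod (n + 1) → ℕ := fun j => multiplicity p (u j) with hb
      have hpE : ¬ p ∣ E := not_dvd_of_isCoprime hp (hcop j₀) hpd
      have hgi : g i = 1 := by
        have h1 := hug i
        have h2 : multiplicity p (u i) = 0 := by
          rw [multiplicity_eq_zero, hui]
          exact hpi.not_dvd_one
        rw [h2, hui, pow_zero, one_mul] at h1
        exact h1.symm
      have hdeg : ∀ j, (u j).natDegree = b j * p.natDegree + (g j).natDegree := by
        intro j
        have := congrArg natDegree (hug j)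
        rwa [(hpm.pow _).natDegree_mul (hg j), hpm.natDegree_pow] at this
      have hlt : ∑ j, (g j).natDegree < N := by
        rw [← hN]
        refine Finset.sum_lt_sum (fun j _ => by rw [hdeg]; omega) ⟨j₀, Finset.mem_univ _, ?_⟩
        rw [hdeg]
        have : b j₀ ≠ 0 := by
          rw [hb]
          dsimp only
          rwa [Ne, multiplicity_eq_zero, not_not]
        have := Nat.mul_ne_zero this hd
        omega
      have hgcop : ∀ j, IsCoprime E (g j) := fun j => by
        have := hcop j
        rw [hug j] at this
        exact this.of_mul_right_right
      have hgloc : ∀ r, IsPrimePoly r → (∃ j, r ∣ g j) →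
          HasLocalFE h i (fun j => multiplicity r (g j)) ((Nat.card F : ℂ) ^ r.natDegree) := by
        rintro r hr ⟨j, hj⟩
        have hrp : ¬ r ∣ p := fun e => hpg j (by rwa [← hr.eq_of_dvd hp e])
        have hrg : ∀ j, multiplicity r (u j) = multiplicity r (g j) := by
          intro j
          have hfin := finiteMultiplicity hr (hu j).ne_zero
          conv_lhs => rw [hug j]
          rw [hug j] at hfin
          rw [multiplicity_mul hr.2.prime hfin, multiplicity_eq_zero.2, zero_add]
          exact fun e => hrp (hr.2.prime.dvd_of_dvd_pow e)
        have := hloc r hr ⟨j, by rw [hug j]; exact hj.mul_left _⟩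
        simpa only [hrg] using this
      set ε : ℂ := (residueSymbol p (E * (g (i - 1) * g (i + 1))) : ℂ) with hεdef
      have hε : ε ^ 2 = 1 := by
        rw [hεdef]
        norm_cast
        refine residueSymbol_sq (hE.mul ((hg _).mul (hg _))) ?_
        exact (hp.isCoprime hpE).mul_right
          ((hp.isCoprime (hpg _)).mul_right (hp.isCoprime (hpg _)))
      obtain ⟨K, -, hK⟩ := exists_twistedSeries_pow_mul hn hH hF i hp hd hg hpg hE b
      rw [← show u = fun j => p ^ b j * g j from funext hug, ← hεdef] at hK
      have hpal := (hloc p hp ⟨j₀, hpd⟩).expand hq hd hε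
      set s := b (i - 1) + b (i + 1) with hs
      have hsdeg : (u (i - 1)).natDegree + (u (i + 1)).natDegree + E.natDegree =
          s * p.natDegree + ((g (i - 1)).natDegree + (g (i + 1)).natDegree + E.natDegree) := by
        rw [hdeg, hdeg, hs]
        ring
      have hEp : IsCoprime E (p ^ (s % 2)) := (hp.isCoprime hpE).symm.pow_right
      have hpsq : Squarefree (p ^ (s % 2)) := by
        rcases Nat.mod_two_eq_zero_or_one s with h0 | h0
        · rw [h0, pow_zero]; exact squarefree_one
        · rw [h0, pow_one]; exact hpi.squarefree
      rw [hK]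
      refine HasFE.C_mul (hpal.hasFE_mul hq (ih _ hlt g hg hgi (E * p ^ (s % 2))
        (hE.mul (hpm.pow _)) (squarefree_mul_iff.2 ⟨hEp.isRelPrime, hsq, hpsq⟩)
        (fun j => (hgcop j).mul_left (hp.isCoprime (hpg j)).pow_left) hgloc rfl) ?_) K
      rw [hsdeg, hE.natDegree_mul (hpm.pow _), hpm.natDegree_pow]
      -- Of the `s * deg p` removed from the conductor degree, the local numerator accounts for the
      -- first summand and the new factor of `E` for the second.
      have h2 : s * p.natDegree = 2 * (s / 2 * p.natDegree) + s % 2 * p.natDegree := by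
        conv_lhs => rw [← Nat.div_add_mod s 2]
        ring
      omega

end


/-! ### The global series as a sum of inner sums -/

section

variable {n : ℕ} {H : LocalWeights n} {c h : (ZMod (n + 1) → ℕ) → ℂ[X]}

section

variable {F : Type} [Field F] [Finite F]

theorem mem_monicTuples_toFinset {a : ZMod (n + 1) → ℕ} {f : ZMod (n + 1) → F[X]} :
    f ∈ (finite_monicTuples F a).toFinset ↔ ∀ j, (f j).Monic ∧ (f j).natDegree = a j := by
  rw [Set.Finite.mem_toFinset]
  rfl

theorem globalSeries_eq_sum (H : LocalWeights n) (i : ZMod (n + 1)) (a : ZMod (n + 1) → ℕ) :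
    globalSeries H F i a =
      ∑ u ∈ (finite_monicTuples F (Function.update a i 0)).toFinset, twistedSeries H i u 1 := by
  ext k
  rw [globalSeries, PowerSeries.coeff_mk, globalCoeff, map_sum]
  simp only [twistedSeries, PowerSeries.coeff_mk, residueSymbol_one_right, Int.cast_one, mul_one]
  rw [← Finset.sum_product']
  symm
  refine Finset.sum_nbij' (fun x => Function.update x.1 i x.2)
    (fun f => (Function.update f i 1, f i)) ?_ ?_ ?_ ?_ ?_
  · rintro ⟨u, m⟩ hum
    rw [Finset.mem_product, mem_monicTuples_toFinset, mem_monics] at hum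
    rw [mem_monicTuples_toFinset]
    intro j
    rcases eq_or_ne j i with rfl | hj
    · simpa using hum.2
    · simpa [hj] using hum.1 j
  · intro f hf
    rw [mem_monicTuples_toFinset] at hf
    rw [Finset.mem_product, mem_monicTuples_toFinset, mem_monics]
    refine ⟨fun j => ?_, by simpa using hf i⟩
    rcases eq_or_ne j i with rfl | hj
    · simp
    · simpa [hj] using hf j
  · rintro ⟨u, m⟩ hum
    rw [Finset.mem_product, mem_monicTuples_toFinset, mem_monics] at hum
    have h1 : u i = 1 := by
      have := hum.1 i
      rw [Function.update_self] at this
      exact this.1.natDegree_eq_zero.1 this.2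
    simp only [Function.update_idem, Function.update_self, Prod.mk.injEq, and_true]
    rw [← h1, Function.update_eq_self]
  · intro f _
    simp
  · intros; rfl

end

/-- The polynomials `c_{a_0, …, k, …, a_n}` (`k` in position `i`) as coefficients of a series. -/
def coeffSeries (c : (ZMod (n + 1) → ℕ) → ℂ[X]) (i : ZMod (n + 1)) (a : ZMod (n + 1) → ℕ) :
    PowerSeries ℂ[X] :=
  PowerSeries.mk fun k => c (Function.update a i k)

theorem map_coeffSeries (h : (ZMod (n + 1) → ℕ) → ℂ[X]) (i : ZMod (n + 1))
    (a : ZMod (n + 1) → ℕ) (Q : ℂ) :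
    PowerSeries.map (evalRingHom Q) (coeffSeries h i a) = localCoeffSeries h i a Q := by
  ext k
  simp [coeffSeries, localCoeffSeries]

theorem map_coeffSeries_eq_globalSeries {F : Type} [Field F] [Finite F]
    (hH : SatisfiesAxioms H c h) (hF : Nat.card F % 4 = 1) (i : ZMod (n + 1))
    (a : ZMod (n + 1) → ℕ) :
    PowerSeries.map (evalRingHom (Nat.card F : ℂ)) (coeffSeries c i a) = globalSeries H F i a := by
  ext k
  simp [coeffSeries, globalSeries, hH.global_eq F hF]

theorem coeffSeries_congr (c : (ZMod (n + 1) → ℕ) → ℂ[X]) (i : ZMod (n + 1))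
    (a : ZMod (n + 1) → ℕ) (k : ℕ) :
    coeffSeries c i (Function.update a i k) = coeffSeries c i a := by
  simp [coeffSeries]

/-! ### Polynomial identities in `q` -/

/-- The powers of `5` are infinitely many field orders congruent to `1` modulo `4`. -/
theorem eq_of_forall_card_eval_eq {P Q : ℂ[X]}
    (hPQ : ∀ (F : Type) [Field F] [Finite F], Nat.card F % 4 = 1 →
      P.eval (Nat.card F : ℂ) = Q.eval (Nat.card F : ℂ)) : P = Q := by
  have : Fact (Nat.Prime 5) := ⟨by norm_num⟩
  refine Polynomial.eq_of_infinite_eval_eq P Q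
    (Set.infinite_of_injective_forall_mem (f := fun r : ℕ => ((5 ^ (r + 1) : ℕ) : ℂ)) ?_ ?_)
  · intro r r' e
    have e : (5 ^ (r + 1) : ℕ) = 5 ^ (r' + 1) := Nat.cast_injective (R := ℂ) e
    have := Nat.pow_right_injective (le_refl 5 |>.trans' (by norm_num)) e
    omega
  · intro r
    have hcard : Nat.card (GaloisField 5 (r + 1)) = 5 ^ (r + 1) :=
      GaloisField.card 5 (r + 1) (Nat.succ_ne_zero r)
    have := hPQ (GaloisField 5 (r + 1)) (by rw [hcard, Nat.pow_mod]; simp)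
    rw [hcard] at this
    exact this

theorem IsPal.of_forall_card {m : ℕ} {φ : PowerSeries ℂ[X]}
    (hφ : ∀ (F : Type) [Field F] [Finite F], Nat.card F % 4 = 1 →
      IsPal (Nat.card F : ℂ) m (PowerSeries.map (evalRingHom (Nat.card F : ℂ)) φ)) :
    IsPal X m φ := by
  refine ⟨fun k l hkl => eq_of_forall_card_eval_eq fun F _ _ hF => ?_,
    fun k hk => eq_of_forall_card_eval_eq fun F _ _ hF => ?_⟩
  · simpa using (hφ F hF).coeff_symm k l hkl
  · simpa using (hφ F hF).coeff_eq_zero k hk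

theorem coeffSeries_c_single (hH : SatisfiesAxioms H c h) (i : ZMod (n + 1)) (k : ℕ) :
    c (Pi.single i k) = X ^ k :=
  eq_of_forall_card_eval_eq fun F _ _ hF => by
    rw [← hH.global_eq F hF, hH.initial_global F hF, eval_pow, eval_X]

theorem coeffSeries_h_single (hH : SatisfiesAxioms H c h) (i : ZMod (n + 1)) (k : ℕ) :
    h (Pi.single i k) = 1 :=
  eq_of_forall_card_eval_eq fun F _ _ hF => by
    have hX : IsPrimePoly (X : F[X]) := ⟨monic_X, irreducible_X⟩
    have h1 := hH.local_eq F hF X hX (Pi.single i k)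
    rw [natDegree_X, pow_one] at h1
    rw [← h1, eval_one, ← hH.initial_local F hF i (X ^ k) (monic_X_pow k)]
    congr 1
    funext j
    rcases eq_or_ne j i with rfl | hj
    · simp
    · simp [hj]

/-! ### Separation of the local and the global part by dominance -/

theorem sum_update (a : ZMod (n + 1) → ℕ) (i : ZMod (n + 1)) (k : ℕ) :
    ∑ j, Function.update a i k j = ∑ j, Function.update a i 0 j + k := by
  rw [Finset.sum_update_of_mem (Finset.mem_univ i), Finset.sum_update_of_mem (Finset.mem_univ i)]
  ring

theorem exists_eq_single_of_sum_eq_one {b : ZMod (n + 1) → ℕ} (hb : ∑ j, b j = 1) :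
    ∃ l, b = Pi.single l 1 := by
  obtain ⟨l, hl⟩ : ∃ l, b l ≠ 0 := by
    by_contra! hcon
    simp [hcon] at hb
  have h1 := Finset.add_sum_erase Finset.univ b (Finset.mem_univ l)
  have h2 : ∑ j ∈ Finset.univ.erase l, b j = 0 := by omega
  refine ⟨l, funext fun j => ?_⟩
  rcases eq_or_ne j l with rfl | hj
  · rw [Pi.single_eq_same]; omega
  · rw [Pi.single_eq_of_ne hj]
    exact Finset.sum_eq_zero_iff.1 h2 j (Finset.mem_erase.2 ⟨hj, Finset.mem_univ j⟩)

theorem coeff_c_eq_zero (hH : SatisfiesAxioms H c h) {b : ZMod (n + 1) → ℕ} (hb : 2 ≤ ∑ j, b j)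
    {j : ℕ} (hj : 2 * j ≤ ∑ j, b j + 1) : (c b).coeff j = 0 := by
  by_contra hne
  have := hH.dominance_c b hb j (mem_support_iff.2 hne)
  omega

theorem coeff_h_eq_zero (hH : SatisfiesAxioms H c h) {b : ZMod (n + 1) → ℕ} (hb : 2 ≤ ∑ j, b j)
    {j : ℕ} (hj : ∑ j, b j ≤ 2 * j + 1) : (h b).coeff j = 0 := by
  by_contra hne
  have := hH.dominance_h b hb j (mem_support_iff.2 hne)
  omega

/-- The terms of the numerator of the global series have large degree. -/
theorem coeff_numer_c_eq_zero (hH : SatisfiesAxioms H c h) (i : ZMod (n + 1))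
    (a : ZMod (n + 1) → ℕ) (s : ℕ) {A : ℕ} (hA : ∑ j, Function.update a i 0 j = A) (hA1 : 1 ≤ A)
    {k : ℕ} (hk : 2 ≤ A + k) {j : ℕ} (hj : 2 * j ≤ A + k + 1) :
    (PowerSeries.coeff k (numer X s (coeffSeries c i a))).coeff j = 0 := by
  have hc : ∀ k, 2 ≤ A + k → ∀ j, 2 * j ≤ A + k + 1 →
      (PowerSeries.coeff k (coeffSeries c i a)).coeff j = 0 := by
    intro k hk j hj
    rw [coeffSeries, PowerSeries.coeff_mk]
    refine coeff_c_eq_zero hH ?_ ?_ <;> rw [sum_update, hA] <;> assumption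
  rw [numer]
  split_ifs with hs
  · exact hc k hk j hj
  · rcases k with _ | k
    · rw [coeff_zero_one_sub_mul]
      exact hc 0 hk j hj
    · rw [coeff_succ_one_sub_mul, coeff_sub, hc _ hk j hj, zero_sub, neg_eq_zero]
      rcases j with _ | j
      · simp
      rw [coeff_X_mul]
      by_cases hAk : 2 ≤ A + k
      · exact hc k hAk j (by omega)
      -- Dominance says nothing about exponent sum `1`; here the coefficient is `q` by the initial
      -- conditions, and its product with `q` still lies beyond the bound.
      · obtain ⟨rfl, rfl⟩ : A = 1 ∧ k = 0 := by omega
        obtain ⟨l, hl⟩ := exists_eq_single_of_sum_eq_one hA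
        rw [coeffSeries, PowerSeries.coeff_mk, hl, coeffSeries_c_single hH, pow_one, coeff_X,
          if_neg (by omega)]

/-- The terms of the numerator of the local series have small degree. -/
theorem coeff_numer_h_eq_zero (hH : SatisfiesAxioms H c h) (i : ZMod (n + 1))
    (a : ZMod (n + 1) → ℕ) (s : ℕ) {A : ℕ} (hA : ∑ j, Function.update a i 0 j = A) (hA1 : 1 ≤ A)
    {k : ℕ} (hk : 2 ≤ A + k) {j : ℕ} (hj : A + k ≤ 2 * j + 1) :
    (PowerSeries.coeff k (numer 1 s (coeffSeries h i a))).coeff j = 0 := by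
  have hc : ∀ k, 2 ≤ A + k → ∀ j, A + k ≤ 2 * j + 1 →
      (PowerSeries.coeff k (coeffSeries h i a)).coeff j = 0 := by
    intro k hk j hj
    rw [coeffSeries, PowerSeries.coeff_mk]
    refine coeff_h_eq_zero hH ?_ ?_ <;> rw [sum_update, hA] <;> assumption
  rw [numer]
  split_ifs with hs
  · exact hc k hk j hj
  · rcases k with _ | k
    · rw [coeff_zero_one_sub_mul]
      exact hc 0 hk j hj
    · rw [coeff_succ_one_sub_mul, coeff_sub, hc _ hk j hj, zero_sub, neg_eq_zero, one_mul]
      by_cases hAk : 2 ≤ A + k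
      · exact hc k hAk j (by omega)
      -- Again exponent sum `1` needs the initial conditions: the coefficient is the constant `1`.
      · obtain ⟨rfl, rfl⟩ : A = 1 ∧ k = 0 := by omega
        obtain ⟨l, hl⟩ := exists_eq_single_of_sum_eq_one hA
        rw [coeffSeries, PowerSeries.coeff_mk, hl, coeffSeries_h_single hH, coeff_one,
          if_neg (by omega)]

theorem eq_zero_of_sub_eq_zero_of_coeff {U V : ℂ[X]} (B : ℕ) (h : U - V = 0)
    (hU : ∀ j, 2 * j ≤ B → U.coeff j = 0) (hV : ∀ j, B ≤ 2 * j → V.coeff j = 0) :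
    U = 0 ∧ V = 0 := by
  have hUV := sub_eq_zero.1 h
  have hU0 : U = 0 := by
    ext j
    rcases le_total (2 * j) B with hj | hj
    · exact hU j hj
    · rw [hUV]; exact hV j hj
  exact ⟨hU0, hUV ▸ hU0⟩

/-- Each reciprocity relation compares a part whose degrees in `q` lie above a cut with a part whose
degrees lie below it. Their difference vanishes, so both do. -/
theorem IsPal.separate (hH : SatisfiesAxioms H c h) (i : ZMod (n + 1))
    (a : ZMod (n + 1) → ℕ) (s : ℕ) {A : ℕ} (hA : ∑ j, Function.update a i 0 j = A) (hA1 : 1 ≤ A)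
    (hsA : s ≤ A)
    (hpal : IsPal X (s / 2)
      (numer X s (coeffSeries c i a) - PowerSeries.C X * numer 1 s (coeffSeries h i a))) :
    IsPal X (s / 2) (numer X s (coeffSeries c i a)) ∧
      IsPal X (s / 2) (numer 1 s (coeffSeries h i a)) := by
  have hP := fun k hk j hj => coeff_numer_c_eq_zero hH i a s hA hA1 (k := k) hk (j := j) hj
  have hR := fun k hk j hj => coeff_numer_h_eq_zero hH i a s hA hA1 (k := k) hk (j := j) hj
  set φ := numer X s (coeffSeries c i a)
  set χ := numer 1 s (coeffSeries h i a)
  set m := s / 2 with hm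
  have hcoeff : ∀ k, PowerSeries.coeff k (φ - PowerSeries.C X * χ) =
      PowerSeries.coeff k φ - X * PowerSeries.coeff k χ := by
    intro k
    rw [map_sub, PowerSeries.coeff_C_mul]
  have h1 : ∀ k l, k + l = 2 * m →
      X ^ k * PowerSeries.coeff l φ = X ^ m * PowerSeries.coeff k φ ∧
      X ^ k * PowerSeries.coeff l χ = X ^ m * PowerSeries.coeff k χ := by
    intro k l hkl
    -- For `m = 0` the symmetry is empty. Otherwise `s ≥ 2` forces `A ≥ 2`, so the degree bounds
    -- cover every coefficient, including `k = 0`.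
    rcases Nat.eq_zero_or_pos m with hm0 | hm0
    · obtain ⟨rfl, rfl⟩ : k = 0 ∧ l = 0 := by omega
      rw [hm0]
      exact ⟨rfl, rfl⟩
    have hA2 : 2 ≤ A := by omega
    have h := hpal.coeff_symm k l hkl
    rw [hcoeff, hcoeff] at h
    have key := eq_zero_of_sub_eq_zero_of_coeff
      (U := X ^ k * PowerSeries.coeff l φ - X ^ m * PowerSeries.coeff k φ)
      (V := X ^ (k + 1) * PowerSeries.coeff l χ - X ^ (m + 1) * PowerSeries.coeff k χ)
      -- This is twice the cut. It serves both terms of each part because `k + l = 2 m` gives `A + l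
      -- + 1 + 2 k = A + k + 1 + 2 m`; the extra factor `X` of the local part raises its bound to
      -- the same value.
      (A + k + 2 * m + 1) (by linear_combination h) ?_ ?_
    · refine ⟨sub_eq_zero.1 key.1, mul_left_cancel₀ (X_ne_zero (R := ℂ)) ?_⟩
      linear_combination key.2
    · intro j hj
      rw [coeff_sub, coeff_X_pow_mul', coeff_X_pow_mul']
      split_ifs
      · rw [hP l (by omega) _ (by omega), hP k (by omega) _ (by omega), sub_zero]
      · rw [hP l (by omega) _ (by omega), sub_zero]
      · rw [hP k (by omega) _ (by omega), sub_zero]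
      · rw [sub_zero]
    · intro j hj
      rw [coeff_sub, coeff_X_pow_mul', coeff_X_pow_mul']
      split_ifs
      · rw [hR l (by omega) _ (by omega), hR k (by omega) _ (by omega), sub_zero]
      · rw [hR l (by omega) _ (by omega), sub_zero]
      · rw [hR k (by omega) _ (by omega), sub_zero]
      · rw [sub_zero]
  have h2 : ∀ k, 2 * m < k → PowerSeries.coeff k φ = 0 ∧ PowerSeries.coeff k χ = 0 := by
    intro k hk
    have h := hpal.coeff_eq_zero k hk
    rw [hcoeff] at h
    have key := eq_zero_of_sub_eq_zero_of_coeff (V := X * PowerSeries.coeff k χ)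
      (A + k + 1) h (fun j hj => hP k (by omega) j hj) ?_
    · exact ⟨key.1, (mul_eq_zero.1 key.2).resolve_left X_ne_zero⟩
    · intro j hj
      rcases j with _ | j
      · omega
      · rw [coeff_X_mul]
        exact hR k (by omega) j (by omega)
  exact ⟨⟨fun k l hkl => (h1 k l hkl).1, fun k hk => (h2 k hk).1⟩,
    ⟨fun k l hkl => (h1 k l hkl).2, fun k hk => (h2 k hk).2⟩⟩

/-! ### Powers of a linear polynomial -/

theorem isPrimePoly_X_sub_C {F : Type} [Field F] (α : F) : IsPrimePoly (X - C α) :=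
  ⟨monic_X_sub_C α, irreducible_X_sub_C α⟩

section

variable {F : Type} [Field F] [Finite F]

/-- The conductor has degree at most `1`, so the functional equation bounds the degree of the
numerator by `0`, and the constant term is `1`. -/
theorem numer_twistedSeries_one (hH : SatisfiesAxioms H c h) (hF : Nat.card F % 4 = 1)
    (i : ZMod (n + 1)) (α : F) (s : ℕ) :
    numer (Nat.card F : ℂ) s (twistedSeries H i 1 ((X - C α) ^ (s % 2))) = 1 := by
  have := Fintype.ofFinite F
  have hp := isPrimePoly_X_sub_C α
  set E := (X - C α) ^ (s % 2) with hE
  have hEm : E.Monic := hp.1.pow _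
  have hEd : E.natDegree = s % 2 := by rw [hE, hp.1.natDegree_pow, natDegree_X_sub_C, mul_one]
  have hEsq : Squarefree E := by
    rcases Nat.mod_two_eq_zero_or_one s with h0 | h0
    · rw [hE, h0, pow_zero]; exact squarefree_one
    · rw [hE, h0, pow_one]; exact hp.2.squarefree
  have h1 : twistedSeries H i 1 E = quadLSeries E := by
    rw [twistedSeries, quadLSeries]
    congr 1
    funext k
    refine Finset.sum_congr rfl fun m hm => ?_
    rw [mem_monics] at hm
    rw [show Function.update (1 : ZMod (n + 1) → F[X]) i m = Pi.mulSingle i m from rfl,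
      hH.initial_local F hF i m hm.1, one_mul]
  have h2 := hasFE_quadLSeries hF hEm hEsq
  have h3 : s % 2 / 2 = 0 := by omega
  have h4 : numer (Nat.card F : ℂ) (s % 2) (quadLSeries E) =
      numer (Nat.card F : ℂ) s (quadLSeries E) := by
    simp [numer]
  rw [HasFE, hEd, h3, h4] at h2
  rw [h1]
  ext k
  rcases k with _ | k
  · have h0 : PowerSeries.coeff 0 (quadLSeries E) = 1 := by
      rw [quadLSeries, PowerSeries.coeff_mk, sum_monics, polysLT_zero]
      simp
    rw [PowerSeries.coeff_zero_one, numer]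
    split_ifs
    · exact h0
    · rw [coeff_zero_one_sub_mul, h0]
  · rw [h2.coeff_eq_zero _ (by omega), PowerSeries.coeff_one, if_neg (by omega)]

/-- With no other prime present the twist and the constant are trivial, and `deg p = 1` makes the
substitution `x ^ deg p` the identity. The remaining `L`-series has numerator `1`. -/
theorem numer_twistedSeries_pow (hn : 2 ≤ n) (hH : SatisfiesAxioms H c h)
    (hF : Nat.card F % 4 = 1) (i : ZMod (n + 1)) (b : ZMod (n + 1) → ℕ) (α : F) :
    numer (Nat.card F : ℂ) (b (i - 1) + b (i + 1))
        (twistedSeries H i (fun j => (X - C α) ^ b j) 1) =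
      numer 1 (b (i - 1) + b (i + 1)) (localCoeffSeries h i b (Nat.card F)) := by
  have hp := isPrimePoly_X_sub_C α
  have hd : (X - C α).natDegree = 1 := natDegree_X_sub_C α
  obtain ⟨K, hK, e⟩ := exists_twistedSeries_pow_mul (g := 1) (E := 1) hn hH hF i hp
    (by rw [hd]; exact one_ne_zero) (fun _ => monic_one) (fun _ => hp.2.not_dvd_one) monic_one b
  have h1 : (fun j => (X - C α) ^ b j * (1 : ZMod (n + 1) → F[X]) j) =
      fun j => (X - C α) ^ b j := by
    funext j
    simp
  have hexp : ∀ (d : ℕ) (hd0 : d ≠ 0) (hd : d = 1) (φ : PowerSeries ℂ),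
      PowerSeries.expand d hd0 φ = φ := by
    rintro d hd0 rfl φ
    exact PowerSeries.expand_one_apply φ
  rw [h1, hK rfl, hexp _ _ hd, hd, pow_one] at e
  rw [e, map_one, one_mul, numer_mul, one_mul (_ ^ _), numer_twistedSeries_one hH hF, mul_one]
  simp

end

/-! ### The functional equations as polynomial identities -/

theorem isPal_X_one : IsPal (X : ℂ[X]) 0 1 := by
  refine ⟨fun k l hkl => ?_, fun k hk => ?_⟩
  · obtain ⟨rfl, rfl⟩ : k = 0 ∧ l = 0 := by omega
    rfl
  · rw [PowerSeries.coeff_one, if_neg (by omega)]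

theorem isPal_coeffSeries_of_sum_eq_zero (hH : SatisfiesAxioms H c h) (i : ZMod (n + 1))
    (a : ZMod (n + 1) → ℕ) (ha : Function.update a i 0 = 0) :
    IsPal X 0 (numer X 0 (coeffSeries c i a)) ∧ IsPal X 0 (numer 1 0 (coeffSeries h i a)) := by
  have h1 : ∀ k, Function.update a i k = Pi.single i k := by
    intro k
    rw [← Function.update_idem (a := i) (v := 0), ha, Pi.single]
  have hc : numer X 0 (coeffSeries c i a) = 1 := by
    rw [numer, if_neg (by norm_num)]
    ext1 k
    rcases k with _ | k
    · rw [coeff_zero_one_sub_mul, coeffSeries, PowerSeries.coeff_mk, h1, coeffSeries_c_single hH]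
      simp
    · rw [coeff_succ_one_sub_mul, coeffSeries, PowerSeries.coeff_mk, PowerSeries.coeff_mk, h1, h1,
        coeffSeries_c_single hH, coeffSeries_c_single hH, PowerSeries.coeff_one,
        if_neg (by omega)]
      ring
  have hh : numer 1 0 (coeffSeries h i a) = 1 := by
    rw [numer, if_neg (by norm_num)]
    ext1 k
    rcases k with _ | k
    · rw [coeff_zero_one_sub_mul, coeffSeries, PowerSeries.coeff_mk, h1, coeffSeries_h_single hH]
      simp
    · rw [coeff_succ_one_sub_mul, coeffSeries, PowerSeries.coeff_mk, PowerSeries.coeff_mk, h1, h1,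
        coeffSeries_h_single hH, coeffSeries_h_single hH, PowerSeries.coeff_one,
        if_neg (by omega)]
      ring
  rw [hc, hh]
  exact ⟨isPal_X_one, isPal_X_one⟩

theorem hasLocalFE_of_isPal {i : ZMod (n + 1)} {b : ZMod (n + 1) → ℕ}
    (hb : IsPal X ((b (i - 1) + b (i + 1)) / 2)
      (numer 1 (b (i - 1) + b (i + 1)) (coeffSeries h i b))) (Q : ℂ) : HasLocalFE h i b Q := by
  have := hb.map (evalRingHom Q)
  rwa [map_numer, map_coeffSeries, map_one, coe_evalRingHom, eval_X] at this

/-- The subtracted series is the contribution of the `q` tuples `(X - C α) ^ b j`. All other tuples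
involve only local series with smaller exponent sum, whose functional equations are supplied by
`hloc`. -/
theorem isPal_numer_sub (hn : 2 ≤ n) (hH : SatisfiesAxioms H c h) {F : Type} [Field F] [Finite F]
    (hF : Nat.card F % 4 = 1) (i : ZMod (n + 1)) (b : ZMod (n + 1) → ℕ) (hbi : b i = 0)
    (hb : b ≠ 0)
    (hloc : ∀ (b' : ZMod (n + 1) → ℕ) (Q : ℂ), ∑ j, b' j < ∑ j, b j → b' i = 0 →
      HasLocalFE h i b' Q) :
    IsPal (Nat.card F : ℂ) ((b (i - 1) + b (i + 1)) / 2)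
      (numer (Nat.card F : ℂ) (b (i - 1) + b (i + 1)) (globalSeries H F i b) -
        PowerSeries.C (Nat.card F : ℂ) *
          numer 1 (b (i - 1) + b (i + 1)) (localCoeffSeries h i b (Nat.card F))) := by
  classical
  have := Fintype.ofFinite F
  have hupd : Function.update b i 0 = b := by rw [← hbi, Function.update_eq_self]
  set T := (finite_monicTuples F b).toFinset with hT
  obtain ⟨j₀, hj₀⟩ : ∃ j, b j ≠ 0 := by
    by_contra! hcon
    exact hb (funext hcon)
  set e : F → ZMod (n + 1) → F[X] := fun α j => (X - C α) ^ b j with he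
  have hinj : Function.Injective e := by
    intro α β hαβ
    have h1 := congrFun hαβ j₀
    simp only [he] at h1
    have h2 := congrArg (eval α) h1
    rw [eval_pow, eval_pow, eval_sub, eval_X, eval_C, sub_self, zero_pow hj₀, eval_sub, eval_X,
      eval_C] at h2
    exact sub_eq_zero.1 (pow_eq_zero_iff hj₀ |>.1 h2.symm)
  have hsub : Finset.univ.image e ⊆ T := by
    intro u hu
    obtain ⟨α, -, rfl⟩ := Finset.mem_image.1 hu
    rw [hT, mem_monicTuples_toFinset]
    intro j
    refine ⟨(monic_X_sub_C α).pow _, ?_⟩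
    simp only [he]
    rw [natDegree_pow, natDegree_X_sub_C, mul_one]
  have hsum : numer (Nat.card F : ℂ) (b (i - 1) + b (i + 1)) (globalSeries H F i b) =
      ∑ u ∈ T \ Finset.univ.image e,
        numer (Nat.card F : ℂ) (b (i - 1) + b (i + 1)) (twistedSeries H i u 1) +
      PowerSeries.C (Nat.card F : ℂ) *
        numer 1 (b (i - 1) + b (i + 1)) (localCoeffSeries h i b (Nat.card F)) := by
    rw [globalSeries_eq_sum, hupd, ← Finset.sum_sdiff hsub, ← numer_sum, numer_add]
    congr 1
    rw [Finset.sum_image hinj.injOn, numer_sum]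
    simp only [he, numer_twistedSeries_pow hn hH hF]
    rw [Finset.sum_const, Finset.card_univ, ← Nat.card_eq_fintype_card, nsmul_eq_mul, map_natCast]
  rw [hsum, add_sub_cancel_right]
  refine IsPal.sum _ fun u hu => ?_
  rw [Finset.mem_sdiff, hT, mem_monicTuples_toFinset] at hu
  obtain ⟨huT, hue⟩ := hu
  have hui : u i = 1 := (huT i).1.natDegree_eq_zero.1 ((huT i).2.trans hbi)
  have key := hasFE_twistedSeries hn hH hF i u (fun j => (huT j).1) hui 1 monic_one squarefree_one
    (fun j => isCoprime_one_left) ?_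
  · rwa [natDegree_one, add_zero, (huT _).2, (huT _).2] at key
  · rintro p hp ⟨j₁, hj₁⟩
    refine hloc _ _ ?_ ?_
    · choose g hg hpg hug using fun j => exists_eq_pow_multiplicity_mul hp (huT j).1
      have hdeg : ∀ j, b j = multiplicity p (u j) * p.natDegree + (g j).natDegree := by
        intro j
        have := congrArg natDegree (hug j)
        rwa [(hp.1.pow _).natDegree_mul (hg j), hp.1.natDegree_pow, (huT j).2] at this
      have hpos := hp.2.natDegree_pos
      have hle : ∀ j, multiplicity p (u j) ≤ b j := by
        intro j
        have := Nat.le_mul_of_pos_right (multiplicity p (u j)) hpos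
        have := hdeg j
        omega
      -- If the exponent sum at `p` were not smaller, `p` would have degree `1` and every `u j`
      -- would be its power `p ^ b j`; but these tuples were removed.
      refine lt_of_le_of_ne (Finset.sum_le_sum fun j _ => hle j) fun heq => hue ?_
      have heq' : ∀ j, multiplicity p (u j) = b j := fun j =>
        (Finset.sum_eq_sum_iff_of_le fun j _ => hle j).1 heq j (Finset.mem_univ j)
      have hne : multiplicity p (u j₁) ≠ 0 := by rwa [Ne, multiplicity_eq_zero, not_not]
      have hd1 : p.natDegree = 1 := by
        have h1 := hdeg j₁
        rw [← heq'] at h1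
        have h2 : multiplicity p (u j₁) * p.natDegree ≤ multiplicity p (u j₁) * 1 := by omega
        have h3 := Nat.le_of_mul_le_mul_left h2 (Nat.pos_of_ne_zero hne)
        omega
      have hpX : p = X - C (-p.coeff 0) := by
        conv_lhs => rw [hp.1.eq_X_add_C hd1]
        rw [C_neg, sub_neg_eq_add]
      refine Finset.mem_image.2 ⟨-p.coeff 0, Finset.mem_univ _, funext fun j => ?_⟩
      have h1 := hdeg j
      rw [hd1, mul_one, heq'] at h1
      have h2 : g j = 1 := (hg j).natDegree_eq_zero.1 (by omega)
      have h3 := hug j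
      rw [h2, mul_one, heq'] at h3
      rw [h3, he]
      dsimp only
      rw [← hpX]
    · rw [multiplicity_eq_zero, hui]
      exact hp.2.not_dvd_one

/-- The functional equations of the global and local series, as identities between
polynomials in `q`. -/
theorem isPal_coeffSeries (hn : 2 ≤ n) (hH : SatisfiesAxioms H c h) (i : ZMod (n + 1))
    (a : ZMod (n + 1) → ℕ) :
    IsPal X ((a (i - 1) + a (i + 1)) / 2)
        (numer X (a (i - 1) + a (i + 1)) (coeffSeries c i a)) ∧
      IsPal X ((a (i - 1) + a (i + 1)) / 2)
        (numer 1 (a (i - 1) + a (i + 1)) (coeffSeries h i a)) := by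
  have hi1 := add_one_ne_self hn i
  have hi2 := sub_one_ne_self hn i
  induction hA : ∑ j, Function.update a i 0 j using Nat.strong_induction_on generalizing a with
  | _ A ih =>
    set b := Function.update a i 0 with hb
    have hbi : b i = 0 := by simp [hb]
    have hb1 : b (i - 1) = a (i - 1) := by simp [hb, hi2]
    have hb2 : b (i + 1) = a (i + 1) := by simp [hb, hi1]
    have hupd : Function.update b i 0 = b := by rw [← hbi, Function.update_eq_self]
    have hbc : ∀ c, coeffSeries c i b = coeffSeries c i a := fun c => coeffSeries_congr c i a 0
    rw [← hb1, ← hb2, ← hbc c, ← hbc h]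
    by_cases hb0 : b = 0
    · have h1 : b (i - 1) + b (i + 1) = 0 := by simp [hb0]
      rw [h1]
      exact isPal_coeffSeries_of_sum_eq_zero hH i b (by rw [hupd, hb0])
    have hA1 : 1 ≤ A := by
      by_contra hlt
      have : ∑ j, b j = 0 := by omega
      exact hb0 (funext fun j => Finset.sum_eq_zero_iff.1 this j (Finset.mem_univ j))
    have hsA : b (i - 1) + b (i + 1) ≤ A := by
      rw [← hA, ← Finset.sum_pair (sub_one_ne_add_one hn i)]
      exact Finset.sum_le_sum_of_subset (Finset.subset_univ _)
    -- Only the difference of the global and local parts is accessible field by field. Passing to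
    -- polynomials in `q` comes first, since dominance can separate the parts only there.
    refine IsPal.separate hH i b _ (by rw [hupd]; exact hA) hA1 hsA (IsPal.of_forall_card ?_)
    intro F _ _ hF
    have hloc : ∀ (b' : ZMod (n + 1) → ℕ) (Q : ℂ), ∑ j, b' j < ∑ j, b j → b' i = 0 →
        HasLocalFE h i b' Q := by
      intro b' Q hlt hb'
      have hupd' : Function.update b' i 0 = b' := by rw [← hb', Function.update_eq_self]
      exact hasLocalFE_of_isPal (ih _ (by rwa [← hA]) b' (by rw [hupd'])).2 Q
    have := isPal_numer_sub hn hH hF i b hbi hb0 hloc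
    rw [map_sub, map_mul, PowerSeries.map_C, map_numer, map_numer,
      map_coeffSeries_eq_globalSeries hH hF, map_coeffSeries, map_one, coe_evalRingHom, eval_X]
    exact this

end


/-! ### Functional equations of rational functions -/

theorem invSubst_coe (q : ℕ) (P : ℂ[X]) :
    invSubst q (P : RatFunc ℂ) = aeval ((q : RatFunc ℂ) * RatFunc.X)⁻¹ P := by
  rw [invSubst, RatFunc.coePolynomial_eq_algebraMap, RatFunc.eval_algebraMap, aeval_def,
    RatFunc.algebraMap_eq_C]
  rfl

/-- `RatFunc.eval` evaluates the reduced numerator and denominator and is not multiplicative when a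
denominator vanishes. The reduced denominator divides `D`, so nonvanishing of `D` at the new point
suffices. -/
theorem invSubst_div (q : ℕ) (N D : ℂ[X])
    (hD : aeval ((q : RatFunc ℂ) * RatFunc.X)⁻¹ D ≠ 0) :
    invSubst q ((N : RatFunc ℂ) / D) * aeval ((q : RatFunc ℂ) * RatFunc.X)⁻¹ D =
      invSubst q (N : RatFunc ℂ) := by
  have hD0 : D ≠ 0 := by rintro rfl; simp at hD
  rw [invSubst_coe]
  set y := ((q : RatFunc ℂ) * RatFunc.X)⁻¹ with hy
  rw [RatFunc.coePolynomial_eq_algebraMap, RatFunc.coePolynomial_eq_algebraMap]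
  set R := algebraMap ℂ[X] (RatFunc ℂ) N / algebraMap ℂ[X] (RatFunc ℂ) D with hR
  obtain ⟨E, hE⟩ := RatFunc.denom_div_dvd N D
  rw [← hR] at hE
  have hden : aeval y (RatFunc.denom R) ≠ 0 := by
    intro h0
    rw [hE, map_mul, h0, zero_mul] at hD
    exact hD rfl
  have hD' : algebraMap ℂ[X] (RatFunc ℂ) D ≠ 0 := by simpa using hD0
  have hden' : algebraMap ℂ[X] (RatFunc ℂ) (RatFunc.denom R) ≠ 0 := by
    simpa using RatFunc.denom_ne_zero R
  have hcross : RatFunc.num R * D = N * RatFunc.denom R := by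
    refine RatFunc.algebraMap_injective ℂ ?_
    rw [map_mul, map_mul, ← div_eq_div_iff hden' hD', RatFunc.num_div_denom]
  have hval : invSubst q R = aeval y (RatFunc.num R) / aeval y (RatFunc.denom R) := by
    rw [invSubst, RatFunc.eval, aeval_def, aeval_def, RatFunc.algebraMap_eq_C]
  have h2 := congrArg (aeval y) hcross
  rw [map_mul, map_mul] at h2
  rw [hval, div_mul_eq_mul_div, h2, mul_div_assoc, div_self hden, mul_one]

theorem sqrtC_sq (q : ℕ) : sqrtC q ^ 2 = (q : RatFunc ℂ) := by
  rw [sqrtC, ← map_pow, ← Complex.ofReal_pow, Real.sq_sqrt (Nat.cast_nonneg q)]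
  simp

theorem IsPal.invSubst {q : ℕ} (hq : q ≠ 0) {m : ℕ} {P : ℂ[X]}
    (h : IsPal (q : ℂ) m (P : PowerSeries ℂ)) :
    (sqrtC q * RatFunc.X) ^ (2 * m) * AffineMDS.invSubst q (P : RatFunc ℂ) = (P : RatFunc ℂ) := by
  have h1 := h.aeval (K := RatFunc ℂ) (Nat.cast_ne_zero.2 hq) RatFunc.X_ne_zero
  rw [map_natCast, RatFunc.aeval_X_left_eq_algebraMap, ← RatFunc.coePolynomial_eq_algebraMap] at h1
  rw [invSubst_coe, pow_mul, mul_pow, sqrtC_sq, h1]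

theorem hasExpansion_coe (P : ℂ[X]) : HasExpansion (P : RatFunc ℂ) (P : PowerSeries ℂ) :=
  (RatFunc.coe_coe P).symm

open scoped RatFunc in
theorem algebraMap_div_eq_coe {K : Type*} [Field K] {N D : K[X]} (hD : D ≠ 0)
    {φ : PowerSeries K} (h : (D : PowerSeries K) * φ = N) :
    algebraMap (RatFunc K) (LaurentSeries K) ((N : RatFunc K) / D) = (φ : LaurentSeries K) := by
  have h1 := congrArg (fun ψ : PowerSeries K => (ψ : LaurentSeries K)) h
  simp only [PowerSeries.coe_mul, RatFunc.coe_coe] at h1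
  have h2 : algebraMap (RatFunc K) (LaurentSeries K) (D : RatFunc K) ≠ 0 := by
    rw [RatFunc.coePolynomial_eq_algebraMap]
    simpa using hD
  rw [map_div₀, div_eq_iff h2, mul_comm]
  exact h1.symm

theorem hasExpansion_div {N D : ℂ[X]} (hD : D ≠ 0) {φ : PowerSeries ℂ}
    (h : (D : PowerSeries ℂ) * φ = N) : HasExpansion ((N : RatFunc ℂ) / D) φ :=
  algebraMap_div_eq_coe hD h

theorem natCast_mul_X_pow_ne_one (q d : ℕ) (hd : d ≠ 0) :
    ((q : RatFunc ℂ) * RatFunc.X) ^ d ≠ 1 := by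
  intro h
  have h1 : algebraMap ℂ[X] (RatFunc ℂ) ((C (q : ℂ) * X) ^ d) = algebraMap ℂ[X] (RatFunc ℂ) 1 := by
    simpa [RatFunc.algebraMap_X] using h
  have h2 := congrArg (eval 0) (RatFunc.algebraMap_injective ℂ h1)
  simp [hd] at h2

/-! ### The one-variable series as polynomials and rational functions -/

section

variable {n : ℕ} {H : LocalWeights n} {c h : (ZMod (n + 1) → ℕ) → ℂ[X]}
  {F : Type} [Field F] [Finite F]

theorem isPal_numer_globalSeries (hn : 2 ≤ n) (hH : SatisfiesAxioms H c h)
    (hF : Nat.card F % 4 = 1) (i : ZMod (n + 1)) (a : ZMod (n + 1) → ℕ) :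
    IsPal (Nat.card F : ℂ) ((a (i - 1) + a (i + 1)) / 2)
      (numer (Nat.card F : ℂ) (a (i - 1) + a (i + 1)) (globalSeries H F i a)) := by
  have := (isPal_coeffSeries hn hH i a).1.map (evalRingHom (Nat.card F : ℂ))
  rwa [map_numer, map_coeffSeries_eq_globalSeries hH hF, coe_evalRingHom, eval_X] at this

theorem localSeries_eq_expand (hH : SatisfiesAxioms H c h) (hF : Nat.card F % 4 = 1)
    {p : F[X]} (hp : IsPrimePoly p) (hd : p.natDegree ≠ 0) (i : ZMod (n + 1))
    (a : ZMod (n + 1) → ℕ) :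
    localSeries H p i a = PowerSeries.expand p.natDegree hd
      (localCoeffSeries h i a ((Nat.card F : ℂ) ^ p.natDegree)) := by
  ext m
  rw [localSeries, PowerSeries.coeff_mk]
  split_ifs with hm
  · obtain ⟨k, rfl⟩ := hm
    rw [Nat.mul_div_cancel_left _ (Nat.pos_of_ne_zero hd), PowerSeries.coeff_expand_mul,
      localCoeffSeries, PowerSeries.coeff_mk, hH.local_eq F hF p hp]
  · rw [PowerSeries.coeff_expand_of_not_dvd _ _ _ hm]

theorem isPal_expand_numer (hn : 2 ≤ n) (hH : SatisfiesAxioms H c h)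
    {p : F[X]} (hd : p.natDegree ≠ 0) (i : ZMod (n + 1)) (a : ZMod (n + 1) → ℕ) :
    IsPal (Nat.card F : ℂ) ((a (i - 1) + a (i + 1)) / 2 * p.natDegree)
      (PowerSeries.expand p.natDegree hd (numer 1 (a (i - 1) + a (i + 1))
        (localCoeffSeries h i a ((Nat.card F : ℂ) ^ p.natDegree)))) := by
  have hq : (Nat.card F : ℂ) ≠ 0 := Nat.cast_ne_zero.2 Nat.card_pos.ne'
  have h1 := (hasLocalFE_of_isPal (isPal_coeffSeries hn hH i a).2
    ((Nat.card F : ℂ) ^ p.natDegree)).expand hq hd (one_pow 2)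
  simpa using h1

theorem exists_globalSeries_of_odd (hn : 2 ≤ n) (hH : SatisfiesAxioms H c h)
    (hF : Nat.card F % 4 = 1) (i : ZMod (n + 1)) (a : ZMod (n + 1) → ℕ) {s : ℕ}
    (hs : s = a (i - 1) + a (i + 1)) (hodd : Odd s) :
    ∃ P : ℂ[X], (P : PowerSeries ℂ) = globalSeries H F i a ∧ P.natDegree ≤ s - 1 ∧
      (sqrtC (Nat.card F) * RatFunc.X) ^ (s - 1) * invSubst (Nat.card F) (P : RatFunc ℂ) =
        (P : RatFunc ℂ) := by
  have h1 := isPal_numer_globalSeries hn hH hF i a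
  rw [← hs, numer, if_pos (Nat.odd_iff.1 hodd)] at h1
  obtain ⟨P, hP, hdeg⟩ := h1.exists_polynomial
  have h2 : s - 1 = 2 * (s / 2) := by
    have := Nat.odd_iff.1 hodd
    omega
  rw [← hP] at h1
  refine ⟨P, hP, h2 ▸ hdeg, ?_⟩
  rw [h2]
  exact h1.invSubst Nat.card_pos.ne'

theorem exists_localSeries_of_odd (hn : 2 ≤ n) (hH : SatisfiesAxioms H c h)
    (hF : Nat.card F % 4 = 1) (i : ZMod (n + 1)) (a : ZMod (n + 1) → ℕ) {s : ℕ}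
    (hs : s = a (i - 1) + a (i + 1)) (hodd : Odd s) {p : F[X]} (hp : IsPrimePoly p) :
    ∃ P : ℂ[X], (P : PowerSeries ℂ) = localSeries H p i a ∧
      P.natDegree ≤ (s - 1) * p.natDegree ∧
      (sqrtC (Nat.card F) * RatFunc.X) ^ ((s - 1) * p.natDegree) *
        invSubst (Nat.card F) (P : RatFunc ℂ) = (P : RatFunc ℂ) := by
  have hd : p.natDegree ≠ 0 := hp.2.natDegree_pos.ne'
  have h1 := isPal_expand_numer hn hH hd i a
  rw [← hs, numer, if_pos (Nat.odd_iff.1 hodd), ← localSeries_eq_expand hH hF hp hd] at h1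
  obtain ⟨P, hP, hdeg⟩ := h1.exists_polynomial
  have h2 : (s - 1) * p.natDegree = 2 * (s / 2 * p.natDegree) := by
    have := Nat.odd_iff.1 hodd
    rw [← mul_assoc]
    congr 1
    omega
  rw [← hP] at h1
  refine ⟨P, hP, h2 ▸ hdeg, ?_⟩
  rw [h2]
  exact h1.invSubst Nat.card_pos.ne'

/-- From a self-reciprocal numerator to the functional equation of the quotient. -/
theorem exists_ratFunc_of_isPal {q m : ℕ} (hq : q ≠ 0) {D : ℂ[X]} {φ : PowerSeries ℂ}
    (hD : aeval ((q : RatFunc ℂ) * RatFunc.X)⁻¹ D ≠ 0)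
    (hpal : IsPal (q : ℂ) m ((D : PowerSeries ℂ) * φ)) :
    ∃ (R : RatFunc ℂ) (N : ℂ[X]), HasExpansion R φ ∧ R = (N : RatFunc ℂ) / (D : RatFunc ℂ) ∧
      N.natDegree ≤ 2 * m ∧
      (sqrtC q * RatFunc.X) ^ (2 * m) * aeval ((q : RatFunc ℂ) * RatFunc.X)⁻¹ D * invSubst q R =
        (D : RatFunc ℂ) * R := by
  have hD0 : D ≠ 0 := by rintro rfl; simp at hD
  have hD' : (D : RatFunc ℂ) ≠ 0 := by
    rw [RatFunc.coePolynomial_eq_algebraMap]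
    simpa using hD0
  obtain ⟨N, hN, hdeg⟩ := hpal.exists_polynomial
  rw [← hN] at hpal
  refine ⟨(N : RatFunc ℂ) / D, N, hasExpansion_div hD0 hN.symm, rfl, hdeg, ?_⟩
  rw [mul_assoc, mul_comm (aeval _ D), invSubst_div q N D hD, hpal.invSubst hq,
    mul_div_cancel₀ _ hD']

theorem exists_globalSeries_of_even (hn : 2 ≤ n) (hH : SatisfiesAxioms H c h)
    (hF : Nat.card F % 4 = 1) (i : ZMod (n + 1)) (a : ZMod (n + 1) → ℕ) {s : ℕ}
    (hs : s = a (i - 1) + a (i + 1)) (heven : Even s) :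
    ∃ (R : RatFunc ℂ) (N : ℂ[X]), HasExpansion R (globalSeries H F i a) ∧
      R = (N : RatFunc ℂ) / (1 - (Nat.card F : RatFunc ℂ) * RatFunc.X) ∧ N.natDegree ≤ s ∧
      (sqrtC (Nat.card F) * RatFunc.X) ^ s * (1 - RatFunc.X⁻¹) * invSubst (Nat.card F) R =
        (1 - (Nat.card F : RatFunc ℂ) * RatFunc.X) * R := by
  have h1 := isPal_numer_globalSeries hn hH hF i a
  set q := Nat.card F with hqdef
  have hq : q ≠ 0 := Nat.card_pos.ne'
  rw [← hs, numer, if_neg (by have := Nat.even_iff.1 heven; omega)] at h1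
  have h2 : s = 2 * (s / 2) := by
    have := Nat.even_iff.1 heven
    omega
  set D : ℂ[X] := 1 - C (q : ℂ) * X with hD
  have hDs : (D : PowerSeries ℂ) = 1 - PowerSeries.C (q : ℂ) * PowerSeries.X := by
    rw [hD, coe_sub, coe_one, coe_mul, coe_C, coe_X]
  have hDr : (D : RatFunc ℂ) = 1 - (q : RatFunc ℂ) * RatFunc.X := by
    rw [RatFunc.coePolynomial_eq_algebraMap, hD, C_eq_natCast, map_sub, map_one, map_mul,
      map_natCast, RatFunc.algebraMap_X]
  have hDa : aeval ((q : RatFunc ℂ) * RatFunc.X)⁻¹ D = 1 - RatFunc.X⁻¹ := by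
    have hq' : (q : RatFunc ℂ) ≠ 0 := Nat.cast_ne_zero.2 hq
    rw [hD, C_eq_natCast, map_sub, map_one, map_mul, map_natCast, aeval_X, mul_inv,
      mul_inv_cancel_left₀ hq']
  have hD0 : (1 - RatFunc.X⁻¹ : RatFunc ℂ) ≠ 0 := by
    intro h0
    have h3 := natCast_mul_X_pow_ne_one 1 1 one_ne_zero
    rw [Nat.cast_one, one_mul, pow_one] at h3
    exact h3 (inv_eq_one.1 (sub_eq_zero.1 h0).symm)
  rw [← hDs] at h1
  have key := exists_ratFunc_of_isPal hq (by rwa [hDa]) h1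
  rwa [hDa, hDr, ← h2] at key

theorem exists_localSeries_of_even (hn : 2 ≤ n) (hH : SatisfiesAxioms H c h)
    (hF : Nat.card F % 4 = 1) (i : ZMod (n + 1)) (a : ZMod (n + 1) → ℕ) {s : ℕ}
    (hs : s = a (i - 1) + a (i + 1)) (heven : Even s) {p : F[X]} (hp : IsPrimePoly p) :
    ∃ (R : RatFunc ℂ) (N : ℂ[X]), HasExpansion R (localSeries H p i a) ∧
      R = (N : RatFunc ℂ) / (1 - RatFunc.X ^ p.natDegree) ∧
      N.natDegree ≤ s * p.natDegree ∧
      (sqrtC (Nat.card F) * RatFunc.X) ^ (s * p.natDegree) *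
          (1 - ((Nat.card F : RatFunc ℂ) ^ p.natDegree)⁻¹ * (RatFunc.X ^ p.natDegree)⁻¹) *
          invSubst (Nat.card F) R =
        (1 - RatFunc.X ^ p.natDegree) * R := by
  have hd : p.natDegree ≠ 0 := hp.2.natDegree_pos.ne'
  have h1 := isPal_expand_numer hn hH hd i a
  set q := Nat.card F with hqdef
  have hq : q ≠ 0 := Nat.card_pos.ne'
  rw [← hs, numer, if_neg (by have := Nat.even_iff.1 heven; omega), map_mul,
    ← localSeries_eq_expand hH hF hp hd] at h1
  have h2 : s * p.natDegree = 2 * (s / 2 * p.natDegree) := by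
    rw [← mul_assoc, Nat.mul_div_cancel' heven.two_dvd]
  set D : ℂ[X] := 1 - X ^ p.natDegree with hD
  have hDs : (D : PowerSeries ℂ) = PowerSeries.expand p.natDegree hd
      (1 - PowerSeries.C (1 : ℂ) * PowerSeries.X) := by
    simp [hD]
  have hDr : (D : RatFunc ℂ) = 1 - RatFunc.X ^ p.natDegree := by
    rw [RatFunc.coePolynomial_eq_algebraMap]
    simp [hD, RatFunc.algebraMap_X]
  have hDa : aeval ((q : RatFunc ℂ) * RatFunc.X)⁻¹ D =
      1 - ((q : RatFunc ℂ) ^ p.natDegree)⁻¹ * (RatFunc.X ^ p.natDegree)⁻¹ := by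
    simp [hD, mul_pow, mul_comm]
  have hD0 : 1 - ((q : RatFunc ℂ) ^ p.natDegree)⁻¹ * (RatFunc.X ^ p.natDegree)⁻¹ ≠ 0 := by
    rw [← mul_inv, ← mul_pow]
    intro h0
    exact natCast_mul_X_pow_ne_one q _ hd (inv_eq_one.1 (sub_eq_zero.1 h0).symm)
  rw [← hDs] at h1
  have key := exists_ratFunc_of_isPal hq (by rwa [hDa]) h1
  rwa [hDa, hDr, ← h2] at key

/-! ### Functional equations of the multiple Dirichlet series -/

theorem insertExp_eq_update (i : ZMod (n + 1)) (b : {j : ZMod (n + 1) // j ≠ i} →₀ ℕ) (k : ℕ) :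
    (insertExp i b k : ZMod (n + 1) → ℕ) = Function.update (insertExp i b 0) i k := by
  funext j
  rcases eq_or_ne j i with rfl | hj
  · simp [insertExp]
  · simp [insertExp, hj]

/-- The positions `i - 1` and `i + 1` are distinct because `n ≥ 2`, so each contributes its own
power of `q^{1/2} x_i`. -/
theorem coeff_sigmaSubst (hn : 2 ≤ n) (q : ℕ) (i : ZMod (n + 1)) (R : SeriesOver i)
    (b : {j : ZMod (n + 1) // j ≠ i} →₀ ℕ) :
    MvPowerSeries.coeff b (sigmaSubst q i R) = invSubst q (MvPowerSeries.coeff b R) *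
      (sqrtC q * RatFunc.X) ^ (insertExp i b 0 (i - 1) + insertExp i b 0 (i + 1)) := by
  classical
  have hi1 := add_one_ne_self hn i
  have hi2 := sub_one_ne_self hn i
  have hne : (⟨i - 1, hi2⟩ : {j : ZMod (n + 1) // j ≠ i}) ≠ ⟨i + 1, hi1⟩ := fun e =>
    sub_one_ne_add_one hn i (Subtype.mk.inj e)
  change invSubst q (MvPowerSeries.coeff b R) * _ = _
  congr 1
  rw [← Finset.mul_prod_erase _ _ (Finset.mem_univ (⟨i - 1, hi2⟩ : {j : ZMod (n + 1) // j ≠ i})),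
    ← Finset.mul_prod_erase _ _ (Finset.mem_erase.2 ⟨hne.symm, Finset.mem_univ _⟩),
    Finset.prod_eq_one, mul_one, pow_add]
  · simp [insertExp, hi1, hi2]
  · intro j hj
    rw [Finset.mem_erase, Finset.mem_erase] at hj
    have h1 : j.1 ≠ i + 1 := fun e => hj.1 (Subtype.ext e)
    have h2 : j.1 ≠ i - 1 := fun e => hj.2.1 (Subtype.ext e)
    rw [if_neg (by tauto), one_pow]

theorem mk_coeff_insertExp_oddPart (hn : 2 ≤ n) (i : ZMod (n + 1))
    (b : {j : ZMod (n + 1) // j ≠ i} →₀ ℕ)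
    (hb : Odd (insertExp i b 0 (i - 1) + insertExp i b 0 (i + 1))) :
    (PowerSeries.mk fun k => MvPowerSeries.coeff (insertExp i b k) (oddPart i (Z H F))) =
      globalSeries H F i (insertExp i b 0) := by
  ext k
  rw [PowerSeries.coeff_mk, globalSeries, PowerSeries.coeff_mk]
  change (if _ then _ else _) = _
  rw [insertExp_eq_update, Function.update_of_ne (sub_one_ne_self hn i),
    Function.update_of_ne (add_one_ne_self hn i), if_pos hb]
  change globalCoeff H F _ = _
  rw [insertExp_eq_update]

theorem mk_coeff_insertExp_evenPart (hn : 2 ≤ n) (i : ZMod (n + 1))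
    (b : {j : ZMod (n + 1) // j ≠ i} →₀ ℕ)
    (hb : Even (insertExp i b 0 (i - 1) + insertExp i b 0 (i + 1))) :
    (PowerSeries.mk fun k => MvPowerSeries.coeff (insertExp i b k) (evenPart i (Z H F))) =
      globalSeries H F i (insertExp i b 0) := by
  ext k
  rw [PowerSeries.coeff_mk, globalSeries, PowerSeries.coeff_mk]
  change (if _ then _ else _) = _
  rw [insertExp_eq_update, Function.update_of_ne (sub_one_ne_self hn i),
    Function.update_of_ne (add_one_ne_self hn i), if_pos hb]
  change globalCoeff H F _ = _
  rw [insertExp_eq_update]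

theorem mk_coeff_insertExp_oddPart_eq_zero (hn : 2 ≤ n) (i : ZMod (n + 1))
    (b : {j : ZMod (n + 1) // j ≠ i} →₀ ℕ)
    (hb : ¬ Odd (insertExp i b 0 (i - 1) + insertExp i b 0 (i + 1))) :
    (PowerSeries.mk fun k => MvPowerSeries.coeff (insertExp i b k) (oddPart i (Z H F))) = 0 := by
  ext k
  rw [PowerSeries.coeff_mk, map_zero]
  change (if _ then _ else _) = _
  rw [insertExp_eq_update, Function.update_of_ne (sub_one_ne_self hn i),
    Function.update_of_ne (add_one_ne_self hn i), if_neg hb]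

theorem mk_coeff_insertExp_evenPart_eq_zero (hn : 2 ≤ n) (i : ZMod (n + 1))
    (b : {j : ZMod (n + 1) // j ≠ i} →₀ ℕ)
    (hb : ¬ Even (insertExp i b 0 (i - 1) + insertExp i b 0 (i + 1))) :
    (PowerSeries.mk fun k => MvPowerSeries.coeff (insertExp i b k) (evenPart i (Z H F))) = 0 := by
  ext k
  rw [PowerSeries.coeff_mk, map_zero]
  change (if _ then _ else _) = _
  rw [insertExp_eq_update, Function.update_of_ne (sub_one_ne_self hn i),
    Function.update_of_ne (add_one_ne_self hn i), if_neg hb]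

theorem hasExpansion_zero : HasExpansion 0 0 := by
  simp [HasExpansion]

theorem invSubst_zero (q : ℕ) : invSubst q 0 = 0 := RatFunc.eval_zero _ _

theorem exists_represents_oddPart (hn : 2 ≤ n) (hH : SatisfiesAxioms H c h)
    (hF : Nat.card F % 4 = 1) (i : ZMod (n + 1)) :
    ∃ R : SeriesOver i, Represents i R (oddPart i (Z H F)) ∧
      sigmaSubst (Nat.card F) i R =
        MvPowerSeries.C (sqrtC (Nat.card F) * RatFunc.X) * R := by
  have key : ∀ b : {j : ZMod (n + 1) // j ≠ i} →₀ ℕ, ∃ R : RatFunc ℂ,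
      HasExpansion R (PowerSeries.mk fun k =>
        MvPowerSeries.coeff (insertExp i b k) (oddPart i (Z H F))) ∧
      invSubst (Nat.card F) R * (sqrtC (Nat.card F) * RatFunc.X) ^
        (insertExp i b 0 (i - 1) + insertExp i b 0 (i + 1)) =
          sqrtC (Nat.card F) * RatFunc.X * R := by
    intro b
    by_cases hb : Odd (insertExp i b 0 (i - 1) + insertExp i b 0 (i + 1))
    · obtain ⟨P, hP, -, hfe⟩ := exists_globalSeries_of_odd (F := F) hn hH hF i (insertExp i b 0)
        rfl hb
      refine ⟨P, ?_, ?_⟩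
      · rw [mk_coeff_insertExp_oddPart hn i b hb, ← hP]
        exact hasExpansion_coe P
      · conv_rhs => rw [← hfe]
        -- The substitution contributes exponent `s`, while the functional equation uses `s - 1`.
        -- Since `s` is odd it is positive, and exactly one factor `q^{1/2} x_i` is left over.
        rw [← mul_assoc, ← pow_succ', Nat.sub_add_cancel hb.pos, mul_comm]
    · refine ⟨0, ?_, ?_⟩
      · rw [mk_coeff_insertExp_oddPart_eq_zero hn i b hb]
        exact hasExpansion_zero
      · rw [invSubst_zero, zero_mul, mul_zero]
  choose R hR hfe using key
  let R' : SeriesOver i := R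
  have hR' : ∀ b, MvPowerSeries.coeff b R' = R b := fun _ => rfl
  refine ⟨R', hR, ?_⟩
  ext1 b
  rw [coeff_sigmaSubst hn, MvPowerSeries.coeff_C_mul, hR']
  exact hfe b

theorem exists_represents_evenPart (hn : 2 ≤ n) (hH : SatisfiesAxioms H c h)
    (hF : Nat.card F % 4 = 1) (i : ZMod (n + 1)) :
    ∃ R : SeriesOver i, Represents i R (evenPart i (Z H F)) ∧
      MvPowerSeries.C (1 - RatFunc.X⁻¹) * sigmaSubst (Nat.card F) i R =
        MvPowerSeries.C (1 - (Nat.card F : RatFunc ℂ) * RatFunc.X) * R := by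
  have key : ∀ b : {j : ZMod (n + 1) // j ≠ i} →₀ ℕ, ∃ R : RatFunc ℂ,
      HasExpansion R (PowerSeries.mk fun k =>
        MvPowerSeries.coeff (insertExp i b k) (evenPart i (Z H F))) ∧
      (1 - RatFunc.X⁻¹) * (invSubst (Nat.card F) R * (sqrtC (Nat.card F) * RatFunc.X) ^
        (insertExp i b 0 (i - 1) + insertExp i b 0 (i + 1))) =
          (1 - (Nat.card F : RatFunc ℂ) * RatFunc.X) * R := by
    intro b
    by_cases hb : Even (insertExp i b 0 (i - 1) + insertExp i b 0 (i + 1))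
    · obtain ⟨R, -, hR, -, -, hfe⟩ :=
        exists_globalSeries_of_even (F := F) hn hH hF i (insertExp i b 0) rfl hb
      refine ⟨R, ?_, ?_⟩
      · rw [mk_coeff_insertExp_evenPart hn i b hb]
        exact hR
      · rw [← hfe]
        ring
    -- Coefficients of the wrong parity are zero on both sides.
    · refine ⟨0, ?_, ?_⟩
      · rw [mk_coeff_insertExp_evenPart_eq_zero hn i b hb]
        exact hasExpansion_zero
      · rw [invSubst_zero, zero_mul, mul_zero, mul_zero]
  choose R hR hfe using key
  let R' : SeriesOver i := R
  have hR' : ∀ b, MvPowerSeries.coeff b R' = R b := fun _ => rfl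
  refine ⟨R', hR, ?_⟩
  ext1 b
  rw [MvPowerSeries.coeff_C_mul, coeff_sigmaSubst hn, MvPowerSeries.coeff_C_mul, hR']
  exact hfe b

end

end

end AffineMDS

/-! ### The main theorem -/

theorem mainTheorem3 (n : ℕ) (hn : 2 ≤ n) (H : LocalWeights n)
    (c h : (ZMod (n + 1) → ℕ) → ℂ[X]) (hH : SatisfiesAxioms H c h)
    (F : Type) [Field F] [Finite F] (q : ℕ) (hq : q = Nat.card F) (hq4 : q % 4 = 1)
    (i : ZMod (n + 1)) :
    -- one-variable series, odd case
    (∀ (a : ZMod (n + 1) → ℕ) (s : ℕ), s = a (i - 1) + a (i + 1) → Odd s →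
      (∃ P : ℂ[X], (P : PowerSeries ℂ) = globalSeries H F i a ∧ P.natDegree ≤ s - 1 ∧
        (sqrtC q * RatFunc.X) ^ (s - 1) * invSubst q (P : RatFunc ℂ) = (P : RatFunc ℂ)) ∧
      (∀ p : F[X], IsPrimePoly p →
        ∃ P : ℂ[X], (P : PowerSeries ℂ) = localSeries H p i a ∧
          P.natDegree ≤ (s - 1) * p.natDegree ∧
          (sqrtC q * RatFunc.X) ^ ((s - 1) * p.natDegree) * invSubst q (P : RatFunc ℂ)
            = (P : RatFunc ℂ))) ∧
    -- one-variable series, even case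
    (∀ (a : ZMod (n + 1) → ℕ) (s : ℕ), s = a (i - 1) + a (i + 1) → Even s →
      (∃ (R : RatFunc ℂ) (N : ℂ[X]), HasExpansion R (globalSeries H F i a) ∧
        R = (N : RatFunc ℂ) / (1 - (q : RatFunc ℂ) * RatFunc.X) ∧ N.natDegree ≤ s ∧
        (sqrtC q * RatFunc.X) ^ s * (1 - RatFunc.X⁻¹) * invSubst q R
          = (1 - (q : RatFunc ℂ) * RatFunc.X) * R) ∧
      (∀ p : F[X], IsPrimePoly p →
        ∃ (R : RatFunc ℂ) (N : ℂ[X]), HasExpansion R (localSeries H p i a) ∧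
          R = (N : RatFunc ℂ) / (1 - RatFunc.X ^ p.natDegree) ∧
          N.natDegree ≤ s * p.natDegree ∧
          (sqrtC q * RatFunc.X) ^ (s * p.natDegree) *
              (1 - ((q : RatFunc ℂ) ^ p.natDegree)⁻¹ * (RatFunc.X ^ p.natDegree)⁻¹) *
              invSubst q R
            = (1 - RatFunc.X ^ p.natDegree) * R)) ∧
    -- functional equations of `Z`
    (∃ R : SeriesOver i, Represents i R (oddPart i (Z H F)) ∧
      sigmaSubst q i R = MvPowerSeries.C (sqrtC q * RatFunc.X) * R) ∧
    (∃ R : SeriesOver i, Represents i R (evenPart i (Z H F)) ∧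
      MvPowerSeries.C (1 - RatFunc.X⁻¹) * sigmaSubst q i R
        = MvPowerSeries.C (1 - (q : RatFunc ℂ) * RatFunc.X) * R) := by
  subst hq
  exact ⟨fun a s hs hodd => ⟨exists_globalSeries_of_odd hn hH hq4 i a hs hodd,
      fun p hp => exists_localSeries_of_odd hn hH hq4 i a hs hodd hp⟩,
    fun a s hs heven => ⟨exists_globalSeries_of_even hn hH hq4 i a hs heven,
      fun p hp => exists_localSeries_of_even hn hH hq4 i a hs heven hp⟩,
    exists_represents_oddPart hn hH hq4 i, exists_represents_evenPart hn hH hq4 i⟩
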